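/- Let $k$ be an algebraically closed field, $Q=\mathbb P^1_k\times\mathbb P^1_k$ and $S=\bigoplus_{a,b\ge 0}H^0(\mathcal O_Q(a,b))=k[x_0,x_1,y_0,y_1]$ its bigraded coordinate ring, where the $x_i$ have bidegree $(1,0)$ and the $y_j$ bidegree $(0,1)$. For a zero-dimensional closed subscheme $X\subset Q$ (possibly non-reduced) let $I(X)\subset S$ be its saturated ideal, $S(X)=S/I(X)$, and for $i,j\in\mathbb Z$ $$M_X(i,j)=\dim_k S(X)_{i,j},\qquad \Delta M_X^{(i,j)}=M_X(i,j)-M_X(i-1,j)-M_X(i,j-1)+M_X(i-1,j-1),$$ with $M_X(i,j)=0$ if $i<0$ or $j<0$. The scheme $X$ is called arithmetically Cohen--Macaulay (ACM) if $\operatorname{depth}S(X)=2$. For a line $L\subset Q$ of type $(1,0)$ or $(0,1)$ with equation $l=0$, let $\#(X\cap L)$ be the degree of the saturation of the ideal $(I(X),l)$, that is, the constant value of the Hilbert function of its quotient in all bidegrees $(i,j)$ with $i,j\gg 0$. Let $X\subset Q$ be an ACM zero-dimensional scheme and let $P\in X$ be a point at which $X$ has multiplicity one, i.e. $\mathcal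 O_{X,P}$ has length $1$. Let $R$ and $C$ be the $(1,0)$-line and the $(0,1)$-line through $P$, and put $Z=X\setminus\{P\}$, $p=\#(Z\cap R)$ and $q=\#(Z\cap C)$ (these numbers are well defined). Then for all $i,j\in\mathbb Z$ $$\Delta M_Z^{(i,j)}=\begin{cases}\Delta M_X^{(i,j)} & \text{if } (i,j)\neq(q,p),\\ \Delta M_X^{(i,j)}-1 & \text{if } (i,j)=(q,p).\end{cases}$$ -/

import Mathlib

noncomputable section

namespace QuadricPoints

open MvPolynomial

/-- The coordinate ring `S = k[x₀, x₁, y₀, y₁]` of `Q = ℙ¹ × ℙ¹`: the variables `x₀, x₁` are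
`X (Sum.inl 0), X (Sum.inl 1)` and `y₀, y₁` are `X (Sum.inr 0), X (Sum.inr 1)`. -/
abbrev CoordRing (k : Type*) [Field k] : Type _ := MvPolynomial (Fin 2 ⊕ Fin 2) k

/-- The bidegrees of the variables: `(1, 0)` for the `xᵢ`, and `(0, 1)` for the `yⱼ`. -/
def bidegree : Fin 2 ⊕ Fin 2 → ℕ × ℕ := Sum.elim (fun _ => (1, 0)) (fun _ => (0, 1))

/-- The space `S_{(a, b)} = H⁰(𝒪_Q(a, b))` of bihomogeneous forms of bidegree `(a, b)`. -/
abbrev forms (k : Type*) [Field k] (d : ℕ × ℕ) : Submodule k (CoordRing k) :=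
  weightedHomogeneousSubmodule k bidegree d

instance (k : Type*) [Field k] : GradedAlgebra (forms k) :=
  weightedGradedAlgebra k bidegree

/-- The closed points of `Q = ℙ¹ × ℙ¹` (over an algebraically closed field). -/
abbrev Point (k : Type*) [Field k] : Type _ :=
  Projectivization k (Fin 2 → k) × Projectivization k (Fin 2 → k)

variable {k : Type*} [Field k]

/-- The value of a polynomial at a chosen pair of homogeneous coordinate vectors of `P`. Whether a
bihomogeneous form vanishes at `P` does not depend on the choice. -/
def valueAt (P : Point k) (f : CoordRing k) : k :=
  MvPolynomial.eval (Sum.elim P.1.rep P.2.rep) f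

/-- The multiplicative set of the polynomials that do not vanish at (the chosen coordinates of)
`P`. Only its bihomogeneous elements matter below. -/
def nonvanishing (P : Point k) : Submonoid (CoordRing k) where
  carrier := {f | valueAt P f ≠ 0}
  one_mem' := by simp [valueAt]
  mul_mem' := by
    intro a b ha hb
    simpa [valueAt] using And.intro ha hb

/-- The local ring `𝒪_{Q, P}`: fractions `f / g` of bihomogeneous forms of the same bidegree with
`g(P) ≠ 0`. -/
abbrev LocalRingAt (P : Point k) : Type _ :=
  HomogeneousLocalization (forms k) (nonvanishing P)

variable (k) in
/-- A zero-dimensional (possibly non-reduced, possibly empty) closed subscheme of `ℙ¹ × ℙ¹`, given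
by the stalks `𝓘_{X, P} ⊆ 𝒪_{Q, P}` of its ideal sheaf: an ideal of finite colength at every point,
equal to the unit ideal at all but finitely many points. -/
structure ZeroDimSubscheme where
  stalkIdeal : ∀ P : Point k, Ideal (LocalRingAt P)
  finite_support : {P | stalkIdeal P ≠ ⊤}.Finite
  finite_length : ∀ P, IsFiniteLength (LocalRingAt P) (LocalRingAt P ⧸ stalkIdeal P)

/-- The dimension of the component of bidegree `(i, j)` of `S / I` (it is `0` if `i < 0` or
`j < 0`). -/
def hilbertFunction (I : Ideal (CoordRing k)) (i j : ℤ) : ℕ :=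
  if 0 ≤ i ∧ 0 ≤ j then
    Module.finrank k
      ((forms k (i.toNat, j.toNat)).map (Ideal.Quotient.mkₐ k I).toLinearMap)
  else 0

variable (k) in
/-- The irrelevant ideal `(xᵢ yⱼ)` of `ℙ¹ × ℙ¹`, with respect to which ideals are saturated. -/
def irrelevantIdeal : Ideal (CoordRing k) :=
  Ideal.span {f | ∃ i j : Fin 2, f = X (Sum.inl i) * X (Sum.inr j)}

variable (k) in
/-- The homogeneous maximal ideal `(x₀, x₁, y₀, y₁)` of `S`. -/
def homogeneousMaximalIdeal : Ideal (CoordRing k) :=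
  Ideal.span (Set.range X)

/-- The saturation of `J`: the `f` with `f · (xᵢ yⱼ)ⁿ ⊆ J` for some `n`. -/
def saturation (J : Ideal (CoordRing k)) : Ideal (CoordRing k) :=
  ⨆ n : ℕ, Submodule.colon J ((irrelevantIdeal k ^ n : Ideal (CoordRing k)) : Set (CoordRing k))

/-- `d` is the degree of the zero-dimensional scheme defined by `J`: the dimension of
`(S / J)_{i, j}` is `d` for all `i, j ≫ 0`. -/
def HasDegree (J : Ideal (CoordRing k)) (d : ℕ) : Prop :=
  ∃ n : ℤ, ∀ i j : ℤ, n ≤ i → n ≤ j → hilbertFunction J i j = d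

/-- The depth of an `R`-module `M` with respect to an ideal `I`: the supremum of the lengths of the
`M`-regular sequences of elements of `I`. -/
def depth {R : Type*} [CommRing R] (I : Ideal R) (M : Type*) [AddCommGroup M] [Module R M] : ℕ∞ :=
  ⨆ rs : {rs : List R // RingTheory.Sequence.IsRegular M rs ∧ ∀ r ∈ rs, r ∈ I},
    (rs.1.length : ℕ∞)

namespace ZeroDimSubscheme

/-- The saturated ideal `I(X) = ⨁ H⁰(𝓘_X(a, b))` of `X`: it is generated by the bihomogeneous forms
`f` such that, at every point `P` of `Q`, the fractions `f / g` with `g(P) ≠ 0` lie in the stalk at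
`P` of the ideal sheaf. -/
def ideal (X : ZeroDimSubscheme k) : Ideal (CoordRing k) :=
  Ideal.span {f | (∃ d : ℕ × ℕ, f ∈ forms k d) ∧
    ∀ (P : Point k) (c : HomogeneousLocalization.NumDenSameDeg (forms k) (nonvanishing P)),
      (c.num : CoordRing k) = f → HomogeneousLocalization.mk c ∈ X.stalkIdeal P}

/-- The Hilbert function `M_X(i, j) = dim_k S(X)_{i, j}`, where `S(X) = S / I(X)`. -/
def hilbertMatrix (X : ZeroDimSubscheme k) (i j : ℤ) : ℕ := hilbertFunction X.ideal i j

/-- The first difference `ΔM_X` of the Hilbert function. -/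
def deltaM (X : ZeroDimSubscheme k) (i j : ℤ) : ℤ :=
  X.hilbertMatrix i j - X.hilbertMatrix (i - 1) j - X.hilbertMatrix i (j - 1)
    + X.hilbertMatrix (i - 1) (j - 1)

/-- `X` is arithmetically Cohen-Macaulay: `depth S(X) = 2`. -/
def IsACM (X : ZeroDimSubscheme k) : Prop :=
  depth (homogeneousMaximalIdeal k) (CoordRing k ⧸ X.ideal) = 2

/-- The multiplicity `m_X(P)`: the length of `𝒪_{X, P} = 𝒪_{Q, P} / 𝓘_{X, P}` (it is `0` iff
`P ∉ X`). -/
def multiplicity (X : ZeroDimSubscheme k) (P : Point k) : ℕ∞ :=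
  Module.length (LocalRingAt P ⧸ X.stalkIdeal P) (LocalRingAt P ⧸ X.stalkIdeal P)

open Classical in
/-- The scheme `X ∖ {P}`: the same as `X` away from `P`, and empty at `P`. -/
def erase (X : ZeroDimSubscheme k) (P : Point k) : ZeroDimSubscheme k where
  stalkIdeal := Function.update X.stalkIdeal P ⊤
  finite_support := by
    refine X.finite_support.subset fun P' h => ?_
    by_cases hP : P' = P
    · subst hP
      simp at h
    · simpa [Function.update_of_ne hP] using h
  finite_length := by
    intro P'
    by_cases hP : P' = P
    · subst hP
      rw [Function.update_self]
      have : Subsingleton (LocalRingAt P' ⧸ (⊤ : Ideal (LocalRingAt P'))) :=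
        Ideal.Quotient.subsingleton_iff.mpr rfl
      exact IsFiniteLength.of_subsingleton
    · rw [Function.update_of_ne hP]
      exact X.finite_length P'

/-- `d = #(X ∩ L)` for the line `L` with equation `l = 0`: the degree of the saturation of the ideal
`(I(X), l)` is `d`. -/
def HasNumPointsOn (X : ZeroDimSubscheme k) (l : CoordRing k) (d : ℕ) : Prop :=
  HasDegree (saturation (X.ideal ⊔ Ideal.span {l})) d

end ZeroDimSubscheme

end QuadricPoints

end

/-! Call `(i, j)` separating if some form of that bidegree lies in `I(Z)` and does not vanish at `P`
(`HasSeparator`), and let `T` be the set of separating bidegrees. Multiplicity one means that `I(X)`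
consists of the forms of `I(Z)` vanishing at `P`, so `M_X - M_Z` is the indicator function of `T`
(`hilbertFunction_erase`). The theorem thus amounts to `T = (q, p) + ℕ²` (`deltaM_erase`).

Two facts give this shape. The numbers `p` and `q` are the least second and first coordinates
occurring in `T` (`LineRestriction.exists_degree`). Indeed, for large `i` the restrictions to `R ≅
ℙ¹` of the forms in `I(Z)` are exactly the multiples of one form on `R`, whose degree is `#(Z ∩ R)`.
It does not vanish at `P`, since `Z` admits some separator of `P` (`exists_separator`) and that
separator restricts to a multiple of it. This part does not need the ACM property.

The ACM property puts the corner `(q, p)` in `T`. Take forms `l`, `m` of bidegrees `(1, 0)`, `(0,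
1)` missing `X`; they form a regular sequence on `S(X)` (`IsACM.exists_sub_mul_mem`). If `F`, `G`
separate `P` in bidegrees `(i + 1, j)`, `(i, j + 1)`, scale them so that `m F - l G` vanishes at
`P`, hence lies in `I(X)`. Regularity gives `F ≡ l z` modulo `I(X)`, and `z` is a separator of
bidegree `(i, j)`. Since `T` is upward closed, this rule leads down to the corner (`corner_mem`). -/

noncomputable section

namespace QuadricPoints

open MvPolynomial

/-! ### Dimension counts for subspaces. -/

section LinearAlgebra

variable {k S : Type*} [Field k] [AddCommGroup S] [Module k S]

theorem finrank_map_add_finrank_inf_ker {T : Type*} [AddCommGroup T] [Module k T]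
    (f : S →ₗ[k] T) (W : Submodule k S) [FiniteDimensional k W] :
    Module.finrank k (W.map f) + Module.finrank k (W ⊓ LinearMap.ker f : Submodule k S) =
      Module.finrank k W := by
  have h := LinearMap.finrank_range_add_finrank_ker (f.domRestrict W)
  rw [LinearMap.range_domRestrict, LinearMap.ker_domRestrict] at h
  rw [← h, ← Submodule.map_comap_subtype,
    (Submodule.equivMapOfInjective W.subtype W.injective_subtype _).finrank_eq]

theorem finrank_map_injective (f : S →ₗ[k] S) (hf : Function.Injective f) (W : Submodule k S) :
    Module.finrank k (W.map f) = Module.finrank k W :=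
  (Submodule.equivMapOfInjective f hf W).finrank_eq.symm

/-- If `f` maps `W` to `W'` and induces an injection `W / U → W' / U'`, then
`dim W - dim U ≤ dim W' - dim U'`. -/
theorem finrank_add_le_of_injective_mod (f : S →ₗ[k] S) (hf : Function.Injective f)
    {W W' U U' : Submodule k S} [FiniteDimensional k W] [FiniteDimensional k W']
    [FiniteDimensional k U] (hW : W.map f ≤ W') (hU : U' ≤ W')
    (h : ∀ w ∈ W, f w ∈ U' → w ∈ U) :
    Module.finrank k W + Module.finrank k U' ≤ Module.finrank k W' + Module.finrank k U := by
  have : FiniteDimensional k U' := Submodule.finiteDimensional_of_le hU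
  have h1 := Submodule.finrank_sup_add_finrank_inf_eq (W.map f) U'
  rw [finrank_map_injective f hf] at h1
  have h2 : Module.finrank k (W.map f ⊔ U' : Submodule k S) ≤ Module.finrank k W' :=
    Submodule.finrank_mono (sup_le hW hU)
  have h3 : Module.finrank k (W.map f ⊓ U' : Submodule k S) ≤ Module.finrank k U := by
    rw [← finrank_map_injective f hf U]
    refine Submodule.finrank_mono ?_
    rintro _ ⟨⟨w, hw, rfl⟩, hw'⟩
    exact ⟨w, h w hw hw', rfl⟩
  omega

end LinearAlgebra

/-- A bounded function on `ℕ × ℕ` that is monotone in both variables is eventually constant in the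
first variable, uniformly in the second. -/
theorem exists_forall_succ_eq_of_monotone_of_le (f : ℕ → ℕ → ℕ) (D : ℕ) (hD : ∀ i j, f i j ≤ D)
    (h1 : ∀ i j, f i j ≤ f (i + 1) j) (h2 : ∀ i j, f i j ≤ f i (j + 1)) :
    ∃ N, ∀ i, N ≤ i → ∀ j, f (i + 1) j = f i j := by
  have m1 : ∀ j, Monotone fun i => f i j := fun j => monotone_nat_of_le_succ fun i => h1 i j
  have m2 : ∀ i, Monotone (f i) := fun i => monotone_nat_of_le_succ fun j => h2 i j
  have key : ∀ j, ∃ N, ∀ i, N ≤ i → f i j = f N j := by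
    intro j
    have hb : BddAbove (Set.range fun i => f i j) := ⟨D, by rintro _ ⟨i, rfl⟩; exact hD i j⟩
    obtain ⟨N, hN⟩ := Nat.sSup_mem (Set.range_nonempty fun i => f i j) hb
    refine ⟨N, fun i hi => le_antisymm ?_ (m1 j hi)⟩
    have hN' : f N j = sSup (Set.range fun i => f i j) := hN
    rw [hN']
    exact le_csSup hb ⟨i, rfl⟩
  choose N hN using key
  have hb : BddAbove (Set.range fun a : ℕ × ℕ => f a.1 a.2) :=
    ⟨D, by rintro _ ⟨i, rfl⟩; exact hD _ _⟩
  obtain ⟨⟨i₀, j₀⟩, h₀⟩ := Nat.sSup_mem (Set.range_nonempty fun a : ℕ × ℕ => f a.1 a.2) hb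
  have hmax : ∀ i j, f i j ≤ f i₀ j₀ := by
    intro i j
    have h₀' : f i₀ j₀ = sSup (Set.range fun a : ℕ × ℕ => f a.1 a.2) := h₀
    rw [h₀']
    exact le_csSup hb ⟨(i, j), rfl⟩
  have hmax' : ∀ i j, i₀ ≤ i → j₀ ≤ j → f i j = f i₀ j₀ := fun i j hi hj =>
    le_antisymm (hmax i j) ((m1 j₀ hi).trans (m2 i hj))
  -- Columns `j ≥ j₀` are constant from `i₀` on; the sum dominates `N j` for each of the finitely
  -- many others.
  refine ⟨i₀ + ∑ j ∈ Finset.range j₀, N j, fun i hi j => ?_⟩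
  by_cases hj : j₀ ≤ j
  · rw [hmax' _ _ (by omega) hj, hmax' _ _ (by omega) hj]
  · have : N j ≤ ∑ j ∈ Finset.range j₀, N j :=
      Finset.single_le_sum (f := N) (fun _ _ => Nat.zero_le _) (by simpa using hj)
    rw [hN j (i + 1) (by omega), hN j i (by omega)]

/-! ### Restriction of a bigraded ideal to a line, in a form that serves both rulings. -/

section Ruling

variable {k S : Type*} [Field k] [CommRing S] [Algebra k S]

/-- Multiplication by a nonzero element of a domain, as an injective linear map. -/
theorem mulLeft_injective_of_ne_zero [IsDomain S] {x : S} (hx : x ≠ 0) :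
    Function.Injective (LinearMap.mulLeft k x) := by
  intro a b h
  simpa [hx] using h

/-- A bigraded family `V` of subspaces of a domain with the Hilbert function of
`ℙ¹ × ℙ¹`, an ideal `J` with bounded Hilbert function, forms `l`, `m` of bidegrees `(1, 0)`,
`(0, 1)` that are nonzerodivisors modulo `J`, the restriction `ρ` to the line `r = 0` of type
`(1, 0)`, and the evaluation `e` at a point of this line. -/
structure LineRestriction (V : ℕ → ℕ → Submodule k S) (J : Ideal S) (r l m : S)
    (ρ : S →ₐ[k] S) (e : S →ₐ[k] k) : Prop where
  finrank_eq : ∀ i j, Module.finrank k (V i j) = (i + 1) * (j + 1)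
  mul_mem : ∀ {i j a b F G}, F ∈ V i j → G ∈ V a b → F * G ∈ V (i + a) (j + b)
  r_mem : r ∈ V 1 0
  l_mem : l ∈ V 1 0
  m_mem : m ∈ V 0 1
  r_ne : r ≠ 0
  ρ_r : ρ r = 0
  ρ_mem : ∀ {i j F}, F ∈ V i j → ρ F ∈ V 0 j
  ρ_eq : ∀ {j F}, F ∈ V 0 j → ρ F = F
  ρ_l : ∃ c : k, c ≠ 0 ∧ ρ l = algebraMap k S c
  e_ρ : ∀ F, e (ρ F) = e F
  e_m : e m ≠ 0
  l_reg : ∀ {i j F}, F ∈ V i j → l * F ∈ J → F ∈ J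
  m_reg : ∀ {i j F}, F ∈ V i j → m * F ∈ J → F ∈ J
  bounded : ∃ D, ∀ i j, Module.finrank k (V i j) ≤
    D + Module.finrank k (V i j ⊓ J.restrictScalars k : Submodule k S)
  mem_sup : ∀ {i j F}, F ∈ V (i + 1) j → F ∈ J ⊔ Ideal.span {r} → ∃ G ∈ V i j, F - r * G ∈ J

namespace LineRestriction

variable {V : ℕ → ℕ → Submodule k S} {J : Ideal S} {r l m : S} {ρ : S →ₐ[k] S} {e : S →ₐ[k] k}
  (D : LineRestriction V J r l m ρ e)

include D

theorem finite (i j : ℕ) : FiniteDimensional k (V i j) :=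
  FiniteDimensional.of_finrank_pos (by rw [D.finrank_eq]; positivity)

theorem ne_zero_m : m ≠ 0 := by
  rintro rfl
  exact D.e_m (map_zero e)

theorem e_l : e l ≠ 0 := by
  obtain ⟨c, hc, h⟩ := D.ρ_l
  rw [← D.e_ρ, h]
  simpa using hc

theorem pow_l_mul_mem {i j : ℕ} {F : S} (hF : F ∈ V i j) (n : ℕ) : l ^ n * F ∈ V (i + n) j := by
  induction n with
  | zero => simpa using hF
  | succ n ih =>
    have := D.mul_mem ih D.l_mem
    rwa [mul_right_comm, ← pow_succ] at this

theorem pow_m_mul_mem {i j : ℕ} {F : S} (hF : F ∈ V i j) (n : ℕ) : m ^ n * F ∈ V i (j + n) := by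
  induction n with
  | zero => simpa using hF
  | succ n ih =>
    have := D.mul_mem ih D.m_mem
    rwa [mul_right_comm, ← pow_succ] at this

theorem ρ_pow_l_mul (n : ℕ) (F : S) : ∃ c : k, c ≠ 0 ∧ ρ (l ^ n * F) = c • ρ F := by
  obtain ⟨c, hc, h⟩ := D.ρ_l
  exact ⟨c ^ n, pow_ne_zero n hc, by rw [map_mul, map_pow, h, ← map_pow, Algebra.smul_def]⟩

/-- Restriction to the line is surjective on forms. -/
theorem map_ρ (i j : ℕ) : (V i j).map ρ.toLinearMap = V 0 j := by
  apply le_antisymm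
  · rintro _ ⟨F, hF, rfl⟩
    exact D.ρ_mem hF
  · intro F hF
    obtain ⟨c, hc, h⟩ := D.ρ_pow_l_mul i F
    refine ⟨c⁻¹ • (l ^ i * F), (V i j).smul_mem _ ?_, ?_⟩
    · simpa using D.pow_l_mul_mem hF i
    · rw [map_smul]
      change c⁻¹ • ρ (l ^ i * F) = F
      rw [h, D.ρ_eq hF, smul_smul, inv_mul_cancel₀ hc, one_smul]

variable [IsDomain S]

theorem ne_zero_l : l ≠ 0 := by
  obtain ⟨c, hc, h⟩ := D.ρ_l
  rintro rfl
  rw [map_zero] at h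
  exact hc ((map_eq_zero (algebraMap k S)).mp h.symm)

/-- The forms that vanish on the line are the multiples of its equation. -/
theorem inf_ker_ρ (i j : ℕ) :
    V (i + 1) j ⊓ LinearMap.ker ρ.toLinearMap = (V i j).map (LinearMap.mulLeft k r) := by
  have := D.finite (i + 1) j
  symm
  refine Submodule.eq_of_le_of_finrank_eq ?_ ?_
  · rintro _ ⟨F, hF, rfl⟩
    refine ⟨?_, ?_⟩
    · have := D.mul_mem hF D.r_mem
      rwa [mul_comm] at this
    · simp [D.ρ_r]
  · have h := finrank_map_add_finrank_inf_ker ρ.toLinearMap (V (i + 1) j)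
    rw [D.map_ρ, D.finrank_eq, D.finrank_eq] at h
    rw [finrank_map_injective _ (mulLeft_injective_of_ne_zero D.r_ne), D.finrank_eq]
    nlinarith

/-- Multiplication by `l` is injective modulo `J`, so the Hilbert function of `S / J` does not
decrease; the additive form avoids truncated subtraction. -/
theorem hilbert_l (i j : ℕ) :
    Module.finrank k (V i j) +
      Module.finrank k (V (i + 1) j ⊓ J.restrictScalars k : Submodule k S) ≤
    Module.finrank k (V (i + 1) j) +
      Module.finrank k (V i j ⊓ J.restrictScalars k : Submodule k S) := by
  have := D.finite i j
  have := D.finite (i + 1) j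
  refine finrank_add_le_of_injective_mod (LinearMap.mulLeft k l)
    (mulLeft_injective_of_ne_zero D.ne_zero_l) ?_ inf_le_left ?_
  · rintro _ ⟨F, hF, rfl⟩
    simpa using D.pow_l_mul_mem hF 1
  · exact fun F hF h => ⟨hF, D.l_reg hF h.2⟩

theorem hilbert_m (i j : ℕ) :
    Module.finrank k (V i j) +
      Module.finrank k (V i (j + 1) ⊓ J.restrictScalars k : Submodule k S) ≤
    Module.finrank k (V i (j + 1)) +
      Module.finrank k (V i j ⊓ J.restrictScalars k : Submodule k S) := by
  have := D.finite i j
  have := D.finite i (j + 1)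
  refine finrank_add_le_of_injective_mod (LinearMap.mulLeft k m)
    (mulLeft_injective_of_ne_zero D.ne_zero_m) ?_ inf_le_left ?_
  · rintro _ ⟨F, hF, rfl⟩
    simpa using D.pow_m_mul_mem hF 1
  · exact fun F hF h => ⟨hF, D.m_reg hF h.2⟩

/-- The Hilbert function of `S / J` is bounded and monotone in both variables. Uniformity in `j`
permits comparing different `j` at one fixed `i`. -/
theorem exists_stable : ∃ N, ∀ i, N ≤ i → ∀ j,
    Module.finrank k (V i j) +
      Module.finrank k (V (i + 1) j ⊓ J.restrictScalars k : Submodule k S) =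
    Module.finrank k (V (i + 1) j) +
      Module.finrank k (V i j ⊓ J.restrictScalars k : Submodule k S) := by
  obtain ⟨B, hB⟩ := D.bounded
  have hle : ∀ i j, Module.finrank k (V i j ⊓ J.restrictScalars k : Submodule k S) ≤
      Module.finrank k (V i j) := fun i j =>
    have := D.finite i j
    Submodule.finrank_mono inf_le_left
  obtain ⟨N, hN⟩ := exists_forall_succ_eq_of_monotone_of_le
    (fun i j => Module.finrank k (V i j) -
      Module.finrank k (V i j ⊓ J.restrictScalars k : Submodule k S)) B
    (fun i j => by have := hB i j; omega)
    (fun i j => by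
      have := D.hilbert_l i j
      have := hle i j
      have := hle (i + 1) j
      omega)
    (fun i j => by
      have := D.hilbert_m i j
      have := hle i j
      have := hle i (j + 1)
      omega)
  refine ⟨N, fun i hi j => ?_⟩
  have h := hN i hi j
  have := hle i j
  have := hle (i + 1) j
  omega

/-- The kernel of `ρ` on `J` in bidegree `(i + 1, j)` is `r · (J : r)` with `(J : r)` taken in
bidegree `(i, j)`. -/
theorem finrank_map_ρ_add (i j : ℕ) :
    Module.finrank k ((V (i + 1) j ⊓ J.restrictScalars k).map ρ.toLinearMap) +
      Module.finrank k
        (V i j ⊓ (J.restrictScalars k).comap (LinearMap.mulLeft k r) : Submodule k S) =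
    Module.finrank k (V (i + 1) j ⊓ J.restrictScalars k : Submodule k S) := by
  have := D.finite (i + 1) j
  have h : V (i + 1) j ⊓ J.restrictScalars k ⊓ LinearMap.ker ρ.toLinearMap =
      (V i j ⊓ (J.restrictScalars k).comap (LinearMap.mulLeft k r)).map
        (LinearMap.mulLeft k r) := by
    rw [inf_right_comm, D.inf_ker_ρ]
    ext F
    constructor
    · rintro ⟨⟨G, hG, rfl⟩, hG'⟩
      exact ⟨G, ⟨hG, hG'⟩, rfl⟩
    · rintro ⟨G, ⟨hG, hG'⟩, rfl⟩
      exact ⟨⟨G, hG, rfl⟩, hG'⟩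
  rw [← finrank_map_add_finrank_inf_ker ρ.toLinearMap (V (i + 1) j ⊓ J.restrictScalars k), h,
    finrank_map_injective _ (mulLeft_injective_of_ne_zero D.r_ne)]

/-- Adding `r` to `J` does not change the image under `ρ`, while the kernel becomes all multiples of
`r`. -/
theorem finrank_inf_sup (i j : ℕ) :
    Module.finrank k
      (V (i + 1) j ⊓ (J ⊔ Ideal.span {r}).restrictScalars k : Submodule k S) =
    Module.finrank k ((V (i + 1) j ⊓ J.restrictScalars k).map ρ.toLinearMap) +
      Module.finrank k (V i j) := by
  have := D.finite (i + 1) j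
  have h1 : (V (i + 1) j ⊓ (J ⊔ Ideal.span {r}).restrictScalars k).map ρ.toLinearMap =
      (V (i + 1) j ⊓ J.restrictScalars k).map ρ.toLinearMap := by
    apply le_antisymm
    · rintro _ ⟨F, ⟨hF, hF'⟩, rfl⟩
      obtain ⟨G, hG, h⟩ := D.mem_sup hF hF'
      have hrG : r * G ∈ V (i + 1) j := by
        have := D.mul_mem hG D.r_mem
        rwa [mul_comm] at this
      refine ⟨F - r * G, ⟨sub_mem hF hrG, h⟩, ?_⟩
      simp [D.ρ_r]
    · refine Submodule.map_mono (inf_le_inf_left _ ?_)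
      intro F hF
      exact Ideal.mem_sup_left hF
  have h2 : V (i + 1) j ⊓ (J ⊔ Ideal.span {r}).restrictScalars k ⊓
      LinearMap.ker ρ.toLinearMap = (V i j).map (LinearMap.mulLeft k r) := by
    rw [inf_right_comm, D.inf_ker_ρ]
    refine inf_eq_left.mpr ?_
    rintro _ ⟨F, hF, rfl⟩
    exact Ideal.mem_sup_right (Ideal.mul_mem_right _ _ (Ideal.mem_span_singleton_self r))
  rw [← finrank_map_add_finrank_inf_ker ρ.toLinearMap
    (V (i + 1) j ⊓ (J ⊔ Ideal.span {r}).restrictScalars k), h1, h2,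
    finrank_map_injective _ (mulLeft_injective_of_ne_zero D.r_ne) (V i j)]

/-- In the stable range the image of `J` has dimension `(j + 1) - dim ((J : r) / J)` with the
quotient in bidegree `(i, j)`. Multiplication by `m` embeds that quotient into the next one, so the
dimension of the image rises by at most one. -/
theorem finrank_map_ρ_succ_le {N : ℕ} (hN : ∀ i, N ≤ i → ∀ j,
    Module.finrank k (V i j) +
      Module.finrank k (V (i + 1) j ⊓ J.restrictScalars k : Submodule k S) =
    Module.finrank k (V (i + 1) j) +
      Module.finrank k (V i j ⊓ J.restrictScalars k : Submodule k S)) {i : ℕ} (hi : N ≤ i) (j : ℕ) :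
    Module.finrank k ((V (i + 1) (j + 1) ⊓ J.restrictScalars k).map ρ.toLinearMap) ≤
      Module.finrank k ((V (i + 1) j ⊓ J.restrictScalars k).map ρ.toLinearMap) + 1 := by
  have := D.finite i j
  have := D.finite i (j + 1)
  have h1 := D.finrank_map_ρ_add i j
  have h2 := D.finrank_map_ρ_add i (j + 1)
  have h3 := hN i hi j
  have h4 := hN i hi (j + 1)
  rw [D.finrank_eq, D.finrank_eq] at h3 h4
  have h5 : Module.finrank k
        (V i j ⊓ (J.restrictScalars k).comap (LinearMap.mulLeft k r) : Submodule k S) +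
      Module.finrank k (V i (j + 1) ⊓ J.restrictScalars k : Submodule k S) ≤
      Module.finrank k
        (V i (j + 1) ⊓ (J.restrictScalars k).comap (LinearMap.mulLeft k r) : Submodule k S) +
      Module.finrank k (V i j ⊓ J.restrictScalars k : Submodule k S) := by
    refine finrank_add_le_of_injective_mod (LinearMap.mulLeft k m)
      (mulLeft_injective_of_ne_zero D.ne_zero_m) ?_ ?_ ?_
    · rintro _ ⟨F, ⟨hF, hF'⟩, rfl⟩
      refine ⟨by simpa using D.pow_m_mul_mem hF 1, ?_⟩
      change r * (m * F) ∈ J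
      rw [mul_left_comm]
      exact J.mul_mem_left _ hF'
    · exact inf_le_inf_left _ fun F hF => J.mul_mem_left _ hF
    · exact fun F hF h => ⟨hF.1, D.m_reg hF.1 h.2⟩
  nlinarith

/-- The degree `d` of the scheme defined by `J ⊔ (r)` is the least `j` such that some form of
bidegree `(i, j)` in `J` does not vanish at a given point of the line `r = 0`. -/
theorem exists_degree (hG : ∃ i j, ∃ G ∈ V i j, G ∈ J ∧ e G ≠ 0) :
    ∃ d N, (∀ i j, N ≤ i → N ≤ j → Module.finrank k
        (V i j ⊓ (J ⊔ Ideal.span {r}).restrictScalars k : Submodule k S) + d =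
          Module.finrank k (V i j)) ∧
      (∃ i, ∃ F ∈ V i d, F ∈ J ∧ e F ≠ 0) ∧
      ∀ i j, ∀ F ∈ V i j, F ∈ J → e F ≠ 0 → d ≤ j := by
  classical
  obtain ⟨i₁, j₁, G, hG, hGJ, heG⟩ := hG
  -- `d` is minimal for a nonzero restriction to the line; that it is also minimal for a nonzero
  -- value at the point is only proved at the end.
  have hex : ∃ d i, ∃ F ∈ V i d, F ∈ J ∧ ρ F ≠ 0 :=
    ⟨j₁, i₁, G, hG, hGJ, fun h => heG (by rw [← D.e_ρ, h, map_zero])⟩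
  obtain ⟨i₀, F₀, hF₀, hF₀J, hρ₀⟩ := Nat.find_spec hex
  set d := Nat.find hex with hd
  have hmin : ∀ i j, ∀ F ∈ V i j, F ∈ J → ρ F ≠ 0 → d ≤ j := fun i j F h1 h2 h3 =>
    Nat.find_min' hex ⟨i, F, h1, h2, h3⟩
  obtain ⟨N, hN⟩ := D.exists_stable
  have hfin := D.finite
  -- the image of `J` under restriction to the line
  have hle : ∀ i, N ≤ i → ∀ n,
      Module.finrank k ((V (i + 1) (d + n) ⊓ J.restrictScalars k).map ρ.toLinearMap) ≤ n + 1 := by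
    intro i hi n
    induction n with
    | zero =>
      -- For `d = 0` there is no smaller degree with zero image to start from, but `V 0 0` is
      -- one-dimensional.
      rcases Nat.eq_zero_or_pos d with h0 | h0
      · have : Module.finrank k ((V (i + 1) d ⊓ J.restrictScalars k).map ρ.toLinearMap) ≤
            Module.finrank k (V 0 d) := by
          rw [← D.map_ρ (i + 1) d]
          have : FiniteDimensional k ((V (i + 1) d).map ρ.toLinearMap) := inferInstance
          exact Submodule.finrank_mono (Submodule.map_mono inf_le_left)
        rw [D.finrank_eq, h0] at this
        rw [h0]
        simpa using this
      · obtain ⟨d', hd'⟩ := Nat.exists_eq_succ_of_ne_zero h0.ne'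
        have h1 := D.finrank_map_ρ_succ_le hN hi d'
        have h2 : (V (i + 1) d' ⊓ J.restrictScalars k).map ρ.toLinearMap = ⊥ := by
          rw [eq_bot_iff]
          rintro _ ⟨F, ⟨hF, hFJ⟩, rfl⟩
          by_contra h
          have := hmin _ _ F hF hFJ h
          omega
        rw [h2, finrank_bot] at h1
        rw [add_zero, hd']
        exact h1
    | succ n ih =>
      have := D.finrank_map_ρ_succ_le hN hi (d + n)
      rw [← add_assoc]
      omega
  -- The multiples of `ρ F₀` already fill the `n + 1` dimensions allowed by `hle`, so the restricted
  -- ideal is principal.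
  have heq : ∀ i, N ≤ i → i₀ ≤ i → ∀ n,
      (V (i + 1) (d + n) ⊓ J.restrictScalars k).map ρ.toLinearMap =
        (V 0 n).map (LinearMap.mulLeft k (ρ F₀)) := by
    intro i hi hi' n
    symm
    have h1 : Module.finrank k ((V 0 n).map (LinearMap.mulLeft k (ρ F₀))) = n + 1 := by
      rw [finrank_map_injective _ (mulLeft_injective_of_ne_zero hρ₀), D.finrank_eq]
      simp
    have h2 : (V 0 n).map (LinearMap.mulLeft k (ρ F₀)) ≤
        (V (i + 1) (d + n) ⊓ J.restrictScalars k).map ρ.toLinearMap := by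
      rintro _ ⟨H, hH, rfl⟩
      obtain ⟨c, hc, h⟩ := D.ρ_pow_l_mul (i + 1 - i₀) F₀
      have h3 := D.pow_l_mul_mem hF₀ (i + 1 - i₀)
      rw [show i₀ + (i + 1 - i₀) = i + 1 by omega] at h3
      refine ⟨c⁻¹ • (l ^ (i + 1 - i₀) * F₀ * H), ⟨?_, ?_⟩, ?_⟩
      · have h4 := D.mul_mem h3 hH
        exact Submodule.smul_mem _ _ (by simpa using h4)
      · exact Submodule.smul_mem _ _ (J.mul_mem_right _ (J.mul_mem_left _ hF₀J))
      · change ρ (c⁻¹ • (l ^ (i + 1 - i₀) * F₀ * H)) = ρ F₀ * H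
        rw [map_smul, map_mul, h, D.ρ_eq hH, smul_mul_assoc, smul_smul, inv_mul_cancel₀ hc,
          one_smul]
    refine Submodule.eq_of_le_of_finrank_le h2 ?_
    rw [h1]
    exact hle i hi n
  refine ⟨d, N + i₀ + d + 1, ?_, ⟨i₀, F₀, hF₀, hF₀J, ?_⟩, ?_⟩
  · intro i j hi hj
    obtain ⟨i, rfl⟩ : ∃ i', i = i' + 1 := ⟨i - 1, by omega⟩
    obtain ⟨n, rfl⟩ := Nat.exists_eq_add_of_le (show d ≤ j by omega)
    rw [D.finrank_inf_sup, heq i (by omega) (by omega),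
      finrank_map_injective _ (mulLeft_injective_of_ne_zero hρ₀), D.finrank_eq, D.finrank_eq,
      D.finrank_eq]
    ring
  -- If `F₀` vanished at the point, so would every form of `J` of large first degree and second
  -- degree at least `d`. Multiplying `G` by powers of `l` and `m` gives one that does not.
  · intro h0
    have h1 := D.pow_l_mul_mem (D.pow_m_mul_mem hG d) (N + i₀ + 1)
    rw [show i₁ + (N + i₀ + 1) = (i₁ + N + i₀) + 1 by omega, add_comm j₁ d] at h1
    have h2 : ρ (l ^ (N + i₀ + 1) * (m ^ d * G)) ∈
        (V (i₁ + N + i₀ + 1) (d + j₁) ⊓ J.restrictScalars k).map ρ.toLinearMap :=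
      ⟨_, ⟨h1, J.mul_mem_left _ (J.mul_mem_left _ hGJ)⟩, rfl⟩
    rw [heq _ (by omega) (by omega)] at h2
    obtain ⟨H, -, hH⟩ := h2
    have h3 := congrArg e hH
    rw [D.e_ρ, LinearMap.mulLeft_apply, map_mul, D.e_ρ, h0, zero_mul, map_mul, map_mul, map_pow,
      map_pow] at h3
    exact mul_ne_zero (pow_ne_zero _ D.e_l) (mul_ne_zero (pow_ne_zero _ D.e_m) heG) h3.symm
  · intro i j F h1 h2 h3
    exact hmin i j F h1 h2 fun h => h3 (by rw [← D.e_ρ, h, map_zero])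

/-- In large bidegrees, every form is modulo `J` a multiple of `l`. -/
theorem exists_forall_sub_mul_mem : ∃ N, ∀ i, N ≤ i → ∀ j, ∀ F ∈ V (i + 1) j,
    ∃ G ∈ V i j, F - l * G ∈ J := by
  obtain ⟨N, hN⟩ := D.exists_stable
  refine ⟨N, fun i hi j F hF => ?_⟩
  have := D.finite i j
  have := D.finite (i + 1) j
  have h1 := Submodule.finrank_sup_add_finrank_inf_eq ((V i j).map (LinearMap.mulLeft k l))
    (V (i + 1) j ⊓ J.restrictScalars k)
  have hl : (V i j).map (LinearMap.mulLeft k l) ≤ V (i + 1) j := by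
    rintro _ ⟨G, hG, rfl⟩
    simpa using D.pow_l_mul_mem hG 1
  have h2 : (V i j).map (LinearMap.mulLeft k l) ⊓ (V (i + 1) j ⊓ J.restrictScalars k) =
      (V i j ⊓ J.restrictScalars k).map (LinearMap.mulLeft k l) := by
    ext G
    constructor
    · rintro ⟨⟨H, hH, rfl⟩, -, hJ⟩
      exact ⟨H, ⟨hH, D.l_reg hH hJ⟩, rfl⟩
    · rintro ⟨H, ⟨hH, hJ⟩, rfl⟩
      exact ⟨⟨H, hH, rfl⟩, hl ⟨H, hH, rfl⟩, J.mul_mem_left _ hJ⟩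
  have hinj := mulLeft_injective_of_ne_zero (k := k) D.ne_zero_l
  rw [h2, finrank_map_injective _ hinj, finrank_map_injective _ hinj] at h1
  -- Stability says that the injection of quotients given by `l` is between spaces of equal
  -- dimension, hence surjective.
  have h3 : (V i j).map (LinearMap.mulLeft k l) ⊔ (V (i + 1) j ⊓ J.restrictScalars k) =
      V (i + 1) j := by
    refine Submodule.eq_of_le_of_finrank_eq (sup_le hl inf_le_left) ?_
    have := hN i hi j
    omega
  rw [← h3] at hF
  obtain ⟨_, ⟨G, hG, rfl⟩, H, hH, rfl⟩ := Submodule.mem_sup.mp hF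
  refine ⟨G, hG, ?_⟩
  rw [LinearMap.mulLeft_apply, add_sub_cancel_left]
  exact hH.2

end LineRestriction

end Ruling

/-! ### Bihomogeneous forms, homogeneous ideals and saturation. -/

section Forms

variable {k : Type*} [Field k]

theorem weight_bidegree (d : Fin 2 ⊕ Fin 2 →₀ ℕ) :
    Finsupp.weight bidegree d =
      (d (Sum.inl 0) + d (Sum.inl 1), d (Sum.inr 0) + d (Sum.inr 1)) := by
  rw [Finsupp.weight_apply, Finsupp.sum_fintype _ _ (by simp)]
  simp [Fintype.sum_sum_type, bidegree, Fin.sum_univ_two, -nsmul_eq_mul]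

/-- The exponents of the monomials of bidegree `(i, j)`. -/
def exponentEquiv (i j : ℕ) :
    {d : Fin 2 ⊕ Fin 2 →₀ ℕ | Finsupp.weight bidegree d = (i, j)} ≃ Fin (i + 1) × Fin (j + 1) where
  toFun d := (⟨d.1 (Sum.inl 0), by
      have h := d.2
      simp only [Set.mem_ofPred_eq, weight_bidegree, Prod.mk.injEq] at h
      omega⟩, ⟨d.1 (Sum.inr 0), by
      have h := d.2
      simp only [Set.mem_ofPred_eq, weight_bidegree, Prod.mk.injEq] at h
      omega⟩)
  invFun a := ⟨Finsupp.equivFunOnFinite.symm (Sum.elim ![a.1, i - a.1] ![a.2, j - a.2]), by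
    have h1 := a.1.2
    have h2 := a.2.2
    simp only [Set.mem_ofPred_eq, weight_bidegree, Prod.mk.injEq]
    simp
    omega⟩
  left_inv d := by
    have h := d.2
    simp only [Set.mem_ofPred_eq, weight_bidegree, Prod.mk.injEq] at h
    ext s
    rcases s with s | s <;> fin_cases s <;> simp <;> omega
  right_inv a := by
    ext <;> simp

theorem finrank_forms (i j : ℕ) : Module.finrank k (forms k (i, j)) = (i + 1) * (j + 1) := by
  have : Fintype {d : Fin 2 ⊕ Fin 2 →₀ ℕ | Finsupp.weight bidegree d = (i, j)} :=
    Fintype.ofEquiv _ (exponentEquiv i j).symm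
  have h : forms k (i, j) = restrictSupport k {d | Finsupp.weight bidegree d = (i, j)} :=
    weightedHomogeneousSubmodule_eq_finsupp_supported k bidegree (i, j)
  rw [h, Module.finrank_eq_card_basis (basisRestrictSupport k _),
    Fintype.card_congr (exponentEquiv i j)]
  simp

instance finiteDimensional_forms (d : ℕ × ℕ) : FiniteDimensional k (forms k d) :=
  FiniteDimensional.of_finrank_pos (by rw [finrank_forms]; positivity)

theorem mul_mem_forms {d e : ℕ × ℕ} {F G : CoordRing k} (hF : F ∈ forms k d) (hG : G ∈ forms k e) :
    F * G ∈ forms k (d + e) :=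
  SetLike.mul_mem_graded hF hG

theorem pow_mem_forms {d : ℕ × ℕ} {F : CoordRing k} (hF : F ∈ forms k d) (n : ℕ) :
    F ^ n ∈ forms k (n • d) :=
  SetLike.pow_mem_graded n hF

theorem X_inl_mem_forms (i : Fin 2) : (X (Sum.inl i) : CoordRing k) ∈ forms k (1, 0) :=
  isWeightedHomogeneous_X k bidegree (Sum.inl i)

theorem X_inr_mem_forms (i : Fin 2) : (X (Sum.inr i) : CoordRing k) ∈ forms k (0, 1) :=
  isWeightedHomogeneous_X k bidegree (Sum.inr i)

theorem pow_mul_pow_mem_forms {l m : CoordRing k} (hl : l ∈ forms k (1, 0))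
    (hm : m ∈ forms k (0, 1)) (d : ℕ × ℕ) : l ^ d.1 * m ^ d.2 ∈ forms k d := by
  have h := mul_mem_forms (pow_mem_forms hl d.1) (pow_mem_forms hm d.2)
  have e : d.1 • ((1, 0) : ℕ × ℕ) + d.2 • ((0, 1) : ℕ × ℕ) = d := by ext <;> simp
  rwa [e] at h

/-- The component of bidegree `d` of a polynomial. -/
def comp (d : ℕ × ℕ) : CoordRing k →+ CoordRing k where
  toFun f := DirectSum.decompose (forms k) f d
  map_zero' := by simp
  map_add' f g := by simp

theorem comp_mem (d : ℕ × ℕ) (f : CoordRing k) : comp d f ∈ forms k d :=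
  (DirectSum.decompose (forms k) f d).2

theorem comp_of_mem {d : ℕ × ℕ} {f : CoordRing k} (hf : f ∈ forms k d) : comp d f = f :=
  DirectSum.decompose_of_mem_same _ hf

theorem comp_of_mem_ne {d e : ℕ × ℕ} {f : CoordRing k} (hf : f ∈ forms k d) (h : d ≠ e) :
    comp e f = 0 :=
  DirectSum.decompose_of_mem_ne _ hf h

theorem comp_mul_of_mem {d : ℕ × ℕ} {f : CoordRing k} (hf : f ∈ forms k d) (e : ℕ × ℕ)
    (g : CoordRing k) : comp (d + e) (f * g) = f * comp e g :=
  DirectSum.coe_decompose_mul_add_of_left_mem (forms k) hf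

theorem comp_mul_of_not_le {d : ℕ × ℕ} {f : CoordRing k} (hf : f ∈ forms k d) {e : ℕ × ℕ}
    (h : ¬d ≤ e) (g : CoordRing k) : comp e (f * g) = 0 :=
  DirectSum.coe_decompose_mul_of_left_mem_of_not_le (forms k) hf h

theorem sum_comp (f : CoordRing k) : ∃ s : Finset (ℕ × ℕ), f = ∑ d ∈ s, comp d f := by
  classical
  exact ⟨_, (DirectSum.sum_support_decompose (forms k) f).symm⟩

theorem comp_mem_of_isHomogeneous {I : Ideal (CoordRing k)} (hI : I.IsHomogeneous (forms k))
    {f : CoordRing k} (hf : f ∈ I) (d : ℕ × ℕ) : comp d f ∈ I :=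
  hI d hf

theorem mem_of_comp_mem {I : Ideal (CoordRing k)} {f : CoordRing k}
    (hf : ∀ d, comp d f ∈ I) : f ∈ I := by
  obtain ⟨s, hs⟩ := sum_comp f
  rw [hs]
  exact Ideal.sum_mem _ fun d _ => hf d

/-- A form that is a nonzerodivisor on forms modulo a homogeneous ideal is a nonzerodivisor. -/
theorem mem_of_mul_mem_of_forms {I : Ideal (CoordRing k)} (hI : I.IsHomogeneous (forms k))
    {e : ℕ × ℕ} {l : CoordRing k} (hl : l ∈ forms k e)
    (h : ∀ d, ∀ F ∈ forms k d, l * F ∈ I → F ∈ I) {f : CoordRing k} (hf : l * f ∈ I) : f ∈ I := by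
  refine mem_of_comp_mem fun d => h d _ (comp_mem d f) ?_
  rw [← comp_mul_of_mem hl]
  exact comp_mem_of_isHomogeneous hI hf _

/-- The cofactor of `r` need not be a form, but as `I` is homogeneous its component of bidegree `d`
serves. -/
theorem exists_sub_mul_mem_of_mem_sup {I : Ideal (CoordRing k)} (hI : I.IsHomogeneous (forms k))
    {e d : ℕ × ℕ} {r F : CoordRing k} (hr : r ∈ forms k e) (hF : F ∈ forms k (e + d))
    (h : F ∈ I ⊔ Ideal.span {r}) : ∃ G ∈ forms k d, F - r * G ∈ I := by
  obtain ⟨u, hu, v, hv, rfl⟩ := Submodule.mem_sup.mp h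
  obtain ⟨a, rfl⟩ := Ideal.mem_span_singleton.mp hv
  refine ⟨comp d a, comp_mem d a, ?_⟩
  rw [← comp_mul_of_mem hr, ← comp_of_mem hF, ← map_sub]
  refine comp_mem_of_isHomogeneous hI ?_ _
  simpa [map_add, comp_of_mem (comp_mem _ _)] using hu

theorem isHomogeneous_sup_span {I : Ideal (CoordRing k)} (hI : I.IsHomogeneous (forms k))
    {e : ℕ × ℕ} {r : CoordRing k} (hr : r ∈ forms k e) :
    (I ⊔ Ideal.span {r}).IsHomogeneous (forms k) :=
  hI.sup (Ideal.homogeneous_span _ _ (by rintro _ rfl; exact ⟨e, hr⟩))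

theorem hilbertFunction_add_finrank (I : Ideal (CoordRing k)) (i j : ℕ) :
    hilbertFunction I i j +
      Module.finrank k (forms k (i, j) ⊓ I.restrictScalars k : Submodule k (CoordRing k)) =
    Module.finrank k (forms k (i, j)) := by
  have h := finrank_map_add_finrank_inf_ker (Ideal.Quotient.mkₐ k I).toLinearMap (forms k (i, j))
  have hk : LinearMap.ker (Ideal.Quotient.mkₐ k I).toLinearMap = I.restrictScalars k := by
    ext f
    simp [Ideal.Quotient.eq_zero_iff_mem]
  rw [hk] at h
  rw [hilbertFunction, if_pos ⟨by positivity, by positivity⟩]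
  exact h

/-- Every form of bidegree at least `(n, n)` lies in the `n`-th power of the irrelevant ideal. -/
theorem forms_subset_irrelevantIdeal_pow {n : ℕ} {d : ℕ × ℕ} (hd : (n, n) ≤ d) {F : CoordRing k}
    (hF : F ∈ forms k d) : F ∈ irrelevantIdeal k ^ n := by
  have key : ∀ (n : ℕ) (a : Fin 2 ⊕ Fin 2 →₀ ℕ), (n, n) ≤ Finsupp.weight bidegree a →
      (monomial a (1 : k)) ∈ irrelevantIdeal k ^ n := by
    intro n
    induction n with
    | zero => simp
    | succ n ih =>
      intro a ha
      have ha' := ha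
      rw [weight_bidegree] at ha'
      obtain ⟨h1, h2⟩ := ha'
      simp only at h1 h2
      obtain ⟨i, hi⟩ : ∃ i : Fin 2, 1 ≤ a (Sum.inl i) := by
        by_cases h : 1 ≤ a (Sum.inl 0)
        · exact ⟨0, h⟩
        · exact ⟨1, by omega⟩
      obtain ⟨j, hj⟩ : ∃ j : Fin 2, 1 ≤ a (Sum.inr j) := by
        by_cases h : 1 ≤ a (Sum.inr 0)
        · exact ⟨0, h⟩
        · exact ⟨1, by omega⟩
      obtain ⟨b, rfl⟩ : ∃ b, a = b + (Finsupp.single (Sum.inl i) 1 +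
          Finsupp.single (Sum.inr j) 1) := by
        refine ⟨a - (Finsupp.single (Sum.inl i) 1 + Finsupp.single (Sum.inr j) 1), ?_⟩
        refine (tsub_add_cancel_of_le ?_).symm
        intro s
        rcases s with s | s
        · by_cases h : s = i
          · subst h; simpa using hi
          · simp [Ne.symm h]
        · by_cases h : s = j
          · subst h; simpa using hj
          · simp [Ne.symm h]
      rw [map_add, map_add, Finsupp.weight_single, Finsupp.weight_single] at ha
      have hb : (n, n) ≤ Finsupp.weight bidegree b := by
        obtain ⟨h3, h4⟩ := ha
        constructor
        · simpa [bidegree] using h3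
        · simpa [bidegree] using h4
      have hm : (monomial (b + (Finsupp.single (Sum.inl i) 1 + Finsupp.single (Sum.inr j) 1))
          (1 : k)) = monomial b 1 * (X (Sum.inl i) * X (Sum.inr j)) := by
        simp [X, monomial_mul]
      rw [hm, pow_succ]
      exact Ideal.mul_mem_mul (ih b hb) (Ideal.subset_span ⟨i, j, rfl⟩)
  rw [F.as_sum]
  refine Ideal.sum_mem _ fun a ha => ?_
  rw [← mul_one (coeff a F), ← C_mul_monomial]
  refine Ideal.mul_mem_left _ _ (key n a ?_)
  rw [show Finsupp.weight bidegree a = d from hF (mem_support_iff.mp ha)]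
  exact hd

/-- The saturation of a homogeneous ideal agrees with the ideal in large bidegrees. -/
theorem exists_forall_mem_of_mem_saturation {K : Ideal (CoordRing k)}
    (hK : K.IsHomogeneous (forms k)) :
    ∃ N, ∀ i j, N ≤ i → N ≤ j → ∀ F ∈ forms k (i, j), F ∈ saturation K → F ∈ K := by
  have hmono : Monotone fun n : ℕ =>
      Submodule.colon K ((irrelevantIdeal k ^ n : Ideal (CoordRing k)) : Set (CoordRing k)) := by
    intro n n' hn
    exact Submodule.colon_mono le_rfl (Ideal.pow_le_pow_right hn)
  -- Arbitrary `s` and `g` are allowed because the generators and coefficients used below need not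
  -- be forms.
  have hmem : ∀ g ∈ saturation K, ∃ N, ∀ s : CoordRing k, ∀ d, (N, N) ≤ d →
      comp d (s * g) ∈ K := by
    intro g hg
    rw [saturation, Submodule.mem_iSup_of_directed _ hmono.directed_le] at hg
    obtain ⟨n, hn⟩ := hg
    obtain ⟨t, ht⟩ := sum_comp g
    -- The sum bounds each bidegree `e` in `t`, so the cofactor in bidegree `d - e` still lies in
    -- the `n`-th power of the irrelevant ideal.
    refine ⟨n + ∑ d ∈ t, (d.1 + d.2), fun s d hd => ?_⟩
    rw [ht, Finset.mul_sum, map_sum]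
    refine Ideal.sum_mem _ fun e he => ?_
    have hle : e.1 + e.2 ≤ ∑ d ∈ t, (d.1 + d.2) :=
      Finset.single_le_sum (f := fun d : ℕ × ℕ => d.1 + d.2) (fun _ _ => Nat.zero_le _) he
    obtain ⟨h1, h2⟩ := hd
    simp only at h1 h2
    obtain ⟨a, rfl⟩ : ∃ a, d = e + a :=
      ⟨(d.1 - e.1, d.2 - e.2), by ext <;> simp <;> omega⟩
    rw [mul_comm, comp_mul_of_mem (comp_mem e g), mul_comm]
    have ha : comp a s ∈ irrelevantIdeal k ^ n := by
      refine forms_subset_irrelevantIdeal_pow ⟨?_, ?_⟩ (comp_mem a s)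
      · simp at h1 ⊢; omega
      · simp at h2 ⊢; omega
    have h3 : comp a s * g ∈ K := by
      rw [mul_comm]
      exact Submodule.mem_colon.mp hn _ ha
    rw [← comp_mul_of_mem (comp_mem a s)]
    exact comp_mem_of_isHomogeneous hK h3 _
  -- Noetherianity turns the bounds for single elements into a common one.
  obtain ⟨T, hT⟩ := IsNoetherian.noetherian (saturation K)
  have hT' : ∀ g ∈ T, g ∈ saturation K := fun g hg => hT ▸ Submodule.subset_span hg
  choose! N hN using fun g hg => hmem g (hT' g hg)
  refine ⟨∑ g ∈ T, N g, fun i j hi hj F hF hFs => ?_⟩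
  rw [← hT, Submodule.mem_span_finset] at hFs
  obtain ⟨c, -, hc⟩ := hFs
  rw [← comp_of_mem hF, ← hc, map_sum]
  refine Ideal.sum_mem _ fun g hg => ?_
  have hle : N g ≤ ∑ g ∈ T, N g :=
    Finset.single_le_sum (f := N) (fun _ _ => Nat.zero_le _) hg
  exact hN g hg _ _ ⟨hle.trans hi, hle.trans hj⟩

theorem le_saturation (K : Ideal (CoordRing k)) : K ≤ saturation K := by
  refine le_trans ?_ (le_iSup _ 0)
  intro f hf
  exact Submodule.mem_colon.mpr fun p _ => K.mul_mem_right _ hf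

/-- If `K` is homogeneous and its Hilbert function is `d` in large bidegrees, then `d` is the degree
of the saturation of `K`. -/
theorem hasDegree_saturation {K : Ideal (CoordRing k)} (hK : K.IsHomogeneous (forms k)) {d N : ℕ}
    (h : ∀ i j, N ≤ i → N ≤ j → Module.finrank k
      (forms k (i, j) ⊓ K.restrictScalars k : Submodule k (CoordRing k)) + d =
        Module.finrank k (forms k (i, j))) :
    HasDegree (saturation K) d := by
  obtain ⟨N', hN'⟩ := exists_forall_mem_of_mem_saturation hK
  refine ⟨(N + N' : ℕ), fun i j hi hj => ?_⟩
  lift i to ℕ using by omega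
  lift j to ℕ using by omega
  have h1 := h i j (by omega) (by omega)
  have h2 := hilbertFunction_add_finrank (saturation K) i j
  have h3 : (forms k (i, j) ⊓ (saturation K).restrictScalars k : Submodule k (CoordRing k)) =
      forms k (i, j) ⊓ K.restrictScalars k := by
    apply le_antisymm
    · exact fun F hF => ⟨hF.1, hN' i j (by omega) (by omega) F hF.1 hF.2⟩
    · exact fun F hF => ⟨hF.1, le_saturation K hF.2⟩
  rw [h3] at h2
  omega

end Forms

/-! ### Consequences of finite length. -/

section FiniteLength

/-- A module of finite length over a `k`-algebra all of whose maximal ideals are the kernel of the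
same homomorphism to `k` is finite-dimensional. -/
theorem finite_of_isFiniteLength {k R : Type*} [Field k] [CommRing R] [Algebra k R]
    (v : R →ₐ[k] k) (hv : ∀ a, v a ≠ 0 → IsUnit a) {M : Type*} [AddCommGroup M] [Module R M]
    (hM : IsFiniteLength R M) : ∀ [Module k M] [IsScalarTower k R M], Module.Finite k M := by
  induction hM with
  | of_subsingleton => intros; infer_instance
  | @of_simple_quotient M _ _ N _ _ ih =>
    intro _ _
    have h1 : Module.Finite k (N.restrictScalars k) := ih
    have h2 : Module.Finite k (M ⧸ N) := by
      have hn : Nontrivial (M ⧸ N) := IsSimpleModule.nontrivial R _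
      obtain ⟨x, hx⟩ := exists_ne (0 : M ⧸ N)
      have hmax := IsSimpleModule.ker_toSpanSingleton_isMaximal R hx
      have hle : LinearMap.ker (LinearMap.toSpanSingleton R (M ⧸ N) x) ≤ RingHom.ker v := by
        intro a ha
        by_contra h
        exact hmax.ne_top (Ideal.eq_top_of_isUnit_mem _ ha (hv a h))
      have heq := hmax.eq_of_le (RingHom.ker_ne_top v) hle
      refine Module.Finite.of_surjective (LinearMap.toSpanSingleton k (M ⧸ N) x) ?_
      intro y
      obtain ⟨a, rfl⟩ := IsSimpleModule.toSpanSingleton_surjective R hx y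
      refine ⟨v a, ?_⟩
      -- The annihilator of `x` is the kernel of `v`, so `a` acts on `x` as the scalar `v a` and the
      -- simple quotient is a line over `k`.
      have h3 : a - algebraMap k R (v a) ∈ LinearMap.ker (LinearMap.toSpanSingleton R (M ⧸ N) x) := by
        rw [heq, RingHom.mem_ker]
        simp
      simp only [LinearMap.mem_ker, LinearMap.toSpanSingleton_apply, sub_smul, algebraMap_smul] at h3
      exact (sub_eq_zero.mp h3).symm
    have h2' : Module.Finite k (M ⧸ N.restrictScalars k) :=
      Module.Finite.equiv (Submodule.Quotient.restrictScalarsEquiv k N).symm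
    exact Module.Finite.of_submodule_quotient (N.restrictScalars k)

/-- In a ring modulo an ideal of finite length, an element lying in every maximal ideal is
nilpotent. -/
theorem exists_pow_mem_of_isFiniteLength {R : Type*} [CommRing R] {I : Ideal R}
    (hI : IsFiniteLength R (R ⧸ I)) {a : R} (ha : ∀ b, IsUnit (1 - a * b)) : ∃ n, a ^ n ∈ I := by
  have := (isFiniteLength_iff_isNoetherian_isArtinian.mp hI).2
  -- The descending chain of the ideals `(aⁿ)` in `R ⧸ I` stops, giving `aⁿ (1 - a b) ∈ I` with a
  -- unit as second factor.
  obtain ⟨n, hn⟩ := IsArtinian.monotone_stabilizes (R := R) (M := R ⧸ I)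
    ⟨fun n => OrderDual.toDual (Submodule.span R {Ideal.Quotient.mk I (a ^ n)}), by
      refine monotone_nat_of_le_succ fun n => ?_
      change Submodule.span R _ ≤ Submodule.span R _
      rw [Submodule.span_singleton_le_iff_mem, Submodule.mem_span_singleton]
      exact ⟨a, by rw [pow_succ', map_mul]; rfl⟩⟩
  have h := hn (n + 1) (Nat.le_succ n)
  have h' : Submodule.span R {Ideal.Quotient.mk I (a ^ n)} =
    Submodule.span R {Ideal.Quotient.mk I (a ^ (n + 1))} := h
  have hmem : Ideal.Quotient.mk I (a ^ n) ∈ Submodule.span R {Ideal.Quotient.mk I (a ^ (n + 1))} :=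
    h' ▸ Submodule.mem_span_singleton_self _
  obtain ⟨b, hb⟩ := Submodule.mem_span_singleton.mp hmem
  refine ⟨n, ?_⟩
  have hb' : Ideal.Quotient.mk I (b * a ^ (n + 1)) = Ideal.Quotient.mk I (a ^ n) := by
    rw [← hb, map_mul]; rfl
  rw [Ideal.Quotient.eq] at hb'
  have h1 : a ^ n * (1 - a * b) ∈ I := by
    rw [← neg_mem_iff]
    convert hb' using 1
    ring
  exact (Ideal.mul_unit_mem_iff_mem I (ha b)).mp h1

end FiniteLength

/-! ### Local rings of the quadric and local membership of forms. -/

section Local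

variable {k : Type*} [Field k]

theorem valueAt_mul (P : Point k) (f g : CoordRing k) :
    valueAt P (f * g) = valueAt P f * valueAt P g := map_mul _ _ _

theorem valueAt_pow (P : Point k) (f : CoordRing k) (n : ℕ) :
    valueAt P (f ^ n) = valueAt P f ^ n := map_pow _ _ _

theorem mem_nonvanishing {P : Point k} {f : CoordRing k} :
    f ∈ nonvanishing P ↔ valueAt P f ≠ 0 := Iff.rfl

variable (P : Point k)

instance localRingModule : Module k (LocalRingAt P) :=
  Function.Injective.module k
    (⟨⟨HomogeneousLocalization.val, HomogeneousLocalization.val_zero⟩,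
      HomogeneousLocalization.val_add⟩ : LocalRingAt P →+ Localization (nonvanishing P))
    (HomogeneousLocalization.val_injective _)
    (fun c x => HomogeneousLocalization.val_smul (nonvanishing P) c x)

instance localRingAlgebra : Algebra k (LocalRingAt P) :=
  Algebra.ofModule
    (fun c x y => HomogeneousLocalization.val_injective _ (by
      rw [HomogeneousLocalization.val_mul, HomogeneousLocalization.val_smul,
        HomogeneousLocalization.val_smul, HomogeneousLocalization.val_mul, smul_mul_assoc]))
    (fun c x y => HomogeneousLocalization.val_injective _ (by
      rw [HomogeneousLocalization.val_mul, HomogeneousLocalization.val_smul,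
        HomogeneousLocalization.val_smul, HomogeneousLocalization.val_mul, mul_smul_comm]))

/-- The fraction `F / g` as a function of the form `F`. -/
def fraction {d : ℕ × ℕ} (g : forms k d) (hg : valueAt P g ≠ 0) :
    forms k d →ₗ[k] LocalRingAt P where
  toFun F := HomogeneousLocalization.mk ⟨d, F, g, hg⟩
  map_add' F G := HomogeneousLocalization.val_injective _ (by
    rw [HomogeneousLocalization.val_add]
    simp only [HomogeneousLocalization.val_mk]
    rw [Localization.add_mk_self]
    rfl)
  map_smul' c F := rfl

/-- The value at `P` of an element of the local ring. -/
def localValueRingHom : LocalRingAt P →+* k :=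
  (IsLocalization.lift (M := nonvanishing P) (S := Localization (nonvanishing P))
      (g := MvPolynomial.eval (Sum.elim P.1.rep P.2.rep)) (fun y => IsUnit.mk0 _ y.2)).comp
    (algebraMap (LocalRingAt P) (Localization (nonvanishing P)))

theorem localValueRingHom_mk
    (c : HomogeneousLocalization.NumDenSameDeg (forms k) (nonvanishing P)) :
    localValueRingHom P (HomogeneousLocalization.mk c) * valueAt P c.den = valueAt P c.num := by
  have h : localValueRingHom P (HomogeneousLocalization.mk c) =
      IsLocalization.lift (M := nonvanishing P) (S := Localization (nonvanishing P))
      (g := MvPolynomial.eval (Sum.elim P.1.rep P.2.rep)) (fun y => IsUnit.mk0 _ y.2)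
      (IsLocalization.mk' _ (c.num : CoordRing k) ⟨c.den, c.den_mem⟩) := by
    rw [← Localization.mk_eq_mk']
    rfl
  rw [h, mul_comm]
  exact ((IsLocalization.lift_mk'_spec (M := nonvanishing P) (S := Localization (nonvanishing P))
      (g := MvPolynomial.eval (Sum.elim P.1.rep P.2.rep)) (hg := fun y => IsUnit.mk0 _ y.2)
      (c.num : CoordRing k) _ ⟨c.den, c.den_mem⟩).mp rfl).symm

/-- The value at `P`, as a homomorphism of `k`-algebras. -/
def localValue : LocalRingAt P →ₐ[k] k where
  toRingHom := localValueRingHom P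
  commutes' c := by
    have h := localValueRingHom_mk P (c • 1)
    simpa [valueAt, Algebra.algebraMap_eq_smul_one] using h

theorem localValue_mk (c : HomogeneousLocalization.NumDenSameDeg (forms k) (nonvanishing P)) :
    localValue P (HomogeneousLocalization.mk c) * valueAt P c.den = valueAt P c.num :=
  localValueRingHom_mk P c

theorem localValue_fraction_eq_zero {d : ℕ × ℕ} (g : forms k d) (hg : valueAt P g ≠ 0)
    (F : forms k d) : localValue P (fraction P g hg F) = 0 ↔ valueAt P F = 0 := by
  have h := localValue_mk P ⟨d, F, g, hg⟩
  rw [← h, mul_eq_zero, or_iff_left hg]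
  rfl

theorem fraction_mul {d e : ℕ × ℕ} (g : forms k d) (hg : valueAt P g ≠ 0) (F : forms k d)
    (h : forms k e) (hh : valueAt P h ≠ 0) (G : forms k e) :
    fraction P ⟨g * h, mul_mem_forms g.2 h.2⟩
        (by rw [valueAt_mul]; exact mul_ne_zero hg hh)
        ⟨F * G, mul_mem_forms F.2 G.2⟩ = fraction P g hg F * fraction P h hh G :=
  rfl

theorem val_fraction {d : ℕ × ℕ} (g : forms k d) (hg : valueAt P g ≠ 0) (F : forms k d) :
    (fraction P g hg F).val =
      Localization.mk (F : CoordRing k) ⟨g, mem_nonvanishing.mpr hg⟩ :=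
  rfl

theorem fraction_eq_fraction {d e : ℕ × ℕ} {g F : forms k d} (hg : valueAt P g ≠ 0)
    {h G : forms k e} (hh : valueAt P h ≠ 0)
    (H : (F : CoordRing k) * h = G * g) : fraction P g hg F = fraction P h hh G := by
  refine HomogeneousLocalization.val_injective _ ?_
  rw [val_fraction, val_fraction, Localization.mk_eq_mk_iff, Localization.r_iff_exists]
  refine ⟨1, ?_⟩
  simp only [OneMemClass.coe_one, one_mul]
  rw [mul_comm, H, mul_comm]

theorem fraction_self {d : ℕ × ℕ} (g : forms k d) (hg : valueAt P g ≠ 0) :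
    fraction P g hg g = 1 := by
  refine HomogeneousLocalization.val_injective _ ?_
  rw [HomogeneousLocalization.val_one]
  exact Localization.mk_self_mk (M := CoordRing k) (S := nonvanishing P) (g : CoordRing k) hg

/-- The inverse of `F / g` is `g / F`. Thus the kernel of `localValue` is the unique maximal ideal,
with residue field `k`. -/
theorem isUnit_of_localValue_ne_zero {a : LocalRingAt P} (ha : localValue P a ≠ 0) : IsUnit a := by
  obtain ⟨⟨d, F, g, hg⟩, rfl⟩ := HomogeneousLocalization.mk_surjective a
  replace hg : valueAt P g ≠ 0 := hg
  have ha' : localValue P (fraction P g hg F) ≠ 0 := ha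
  have hF : valueAt P F ≠ 0 := fun h => ha' ((localValue_fraction_eq_zero P g hg F).mpr h)
  change IsUnit (fraction P g hg F)
  refine IsUnit.of_mul_eq_one (fraction P F hF g) ?_
  rw [← fraction_mul, ← fraction_self P g hg]
  exact fraction_eq_fraction P _ _ (by ring)

theorem exists_rep_ne_zero (p : Projectivization k (Fin 2 → k)) : ∃ i, p.rep i ≠ 0 :=
  Function.ne_iff.mp p.rep_nonzero

theorem exists_form_valueAt_ne_zero (d : ℕ × ℕ) : ∃ g : forms k d, valueAt P g ≠ 0 := by
  obtain ⟨i, hi⟩ := exists_rep_ne_zero P.1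
  obtain ⟨j, hj⟩ := exists_rep_ne_zero P.2
  refine ⟨⟨_, pow_mul_pow_mem_forms (X_inl_mem_forms i) (X_inr_mem_forms j) d⟩, ?_⟩
  rw [valueAt_mul, valueAt_pow, valueAt_pow]
  exact mul_ne_zero (pow_ne_zero _ (by simpa [valueAt] using hi))
    (pow_ne_zero _ (by simpa [valueAt] using hj))

variable {P}

/-- All fractions with numerator `F` lie in the ideal `𝔞` of the local ring. -/
def LocallyIn (𝔞 : Ideal (LocalRingAt P)) (F : CoordRing k) : Prop :=
  ∀ c : HomogeneousLocalization.NumDenSameDeg (forms k) (nonvanishing P),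
    (c.num : CoordRing k) = F → HomogeneousLocalization.mk c ∈ 𝔞

variable {𝔞 : Ideal (LocalRingAt P)}

/-- One denominator suffices, since `F / g' = (F / g)(g / g')`. A nonzero form determines its
bidegree; zero has every bidegree and is treated apart. -/
theorem locallyIn_iff {d : ℕ × ℕ} (g : forms k d) (hg : valueAt P g ≠ 0) (F : forms k d) :
    LocallyIn 𝔞 F ↔ fraction P g hg F ∈ 𝔞 := by
  refine ⟨fun h => h _ rfl, fun h c hc => ?_⟩
  by_cases h0 : (F : CoordRing k) = 0
  · have : HomogeneousLocalization.mk c = 0 := by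
      refine HomogeneousLocalization.val_injective _ ?_
      rw [HomogeneousLocalization.val_mk, hc, h0, Localization.mk_zero,
        HomogeneousLocalization.val_zero]
    rw [this]
    exact zero_mem _
  · obtain ⟨e, num, den, hden⟩ := c
    replace hden : valueAt P den ≠ 0 := hden
    simp only at hc
    have he : e = d := by
      have h1 : IsWeightedHomogeneous bidegree (F : CoordRing k) d := F.2
      have h2 : IsWeightedHomogeneous bidegree (F : CoordRing k) e := hc ▸ num.2
      exact h2.inj_right h0 h1
    subst he
    obtain rfl : num = F := Subtype.ext hc
    have h2 := 𝔞.mul_mem_right (fraction P den hden g) h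
    convert h2 using 1
    rw [← fraction_mul]
    exact fraction_eq_fraction P hden _ (by ring)

theorem locallyIn_top (F : CoordRing k) : LocallyIn (⊤ : Ideal (LocalRingAt P)) F :=
  fun _ _ => trivial

theorem locallyIn_zero : LocallyIn 𝔞 0 := by
  obtain ⟨g, hg⟩ := exists_form_valueAt_ne_zero P 0
  have h := (locallyIn_iff (𝔞 := 𝔞) g hg 0).mpr (by rw [map_zero]; exact zero_mem _)
  exact h

theorem LocallyIn.add {d : ℕ × ℕ} {F G : CoordRing k} (hF : F ∈ forms k d) (hG : G ∈ forms k d)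
    (h : LocallyIn 𝔞 F) (h' : LocallyIn 𝔞 G) : LocallyIn 𝔞 (F + G) := by
  obtain ⟨g, hg⟩ := exists_form_valueAt_ne_zero P d
  have h1 := (locallyIn_iff g hg ⟨F, hF⟩).mp h
  have h2 := (locallyIn_iff g hg ⟨G, hG⟩).mp h'
  refine (locallyIn_iff g hg (⟨F, hF⟩ + ⟨G, hG⟩)).mpr ?_
  rw [map_add]
  exact add_mem h1 h2

theorem LocallyIn.mul_left {d e : ℕ × ℕ} {F G : CoordRing k} (hG : G ∈ forms k e)
    (hF : F ∈ forms k d) (h : LocallyIn 𝔞 F) : LocallyIn 𝔞 (G * F) := by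
  obtain ⟨g, hg⟩ := exists_form_valueAt_ne_zero P d
  obtain ⟨g', hg'⟩ := exists_form_valueAt_ne_zero P e
  have h1 := (locallyIn_iff g hg ⟨F, hF⟩).mp h
  refine (locallyIn_iff (P := P) (k := k) (d := e + d) ⟨g' * g, mul_mem_forms g'.2 g.2⟩
    (by rw [valueAt_mul]; exact mul_ne_zero hg' hg) ⟨G * F, mul_mem_forms hG hF⟩).mpr ?_
  rw [fraction_mul P g' hg' ⟨G, hG⟩ g hg ⟨F, hF⟩]
  exact 𝔞.mul_mem_left _ h1

theorem LocallyIn.of_mul_left {d e : ℕ × ℕ} {F G : CoordRing k} (hG : G ∈ forms k e)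
    (hGP : valueAt P G ≠ 0) (hF : F ∈ forms k d) (h : LocallyIn 𝔞 (G * F)) : LocallyIn 𝔞 F := by
  obtain ⟨g, hg⟩ := exists_form_valueAt_ne_zero P d
  have h1 := (locallyIn_iff (P := P) (k := k) (d := e + d) ⟨G * g, mul_mem_forms hG g.2⟩
    (by rw [valueAt_mul]; exact mul_ne_zero hGP hg) ⟨G * F, mul_mem_forms hG hF⟩).mp h
  rw [fraction_mul P ⟨G, hG⟩ hGP ⟨G, hG⟩ g hg ⟨F, hF⟩, fraction_self, one_mul] at h1
  exact (locallyIn_iff g hg ⟨F, hF⟩).mpr h1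

/-- A power of a form that vanishes at `P` lies locally in any ideal of finite colength. -/
theorem exists_pow_locallyIn (h𝔞 : IsFiniteLength (LocalRingAt P) (LocalRingAt P ⧸ 𝔞))
    {d : ℕ × ℕ} {F : CoordRing k} (hF : F ∈ forms k d) (hFP : valueAt P F = 0) :
    ∃ n, LocallyIn 𝔞 (F ^ n) := by
  obtain ⟨g, hg⟩ := exists_form_valueAt_ne_zero P d
  have h0 := (localValue_fraction_eq_zero P g hg ⟨F, hF⟩).mpr hFP
  obtain ⟨n, hn⟩ := exists_pow_mem_of_isFiniteLength h𝔞 (a := fraction P g hg ⟨F, hF⟩)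
    (fun b => isUnit_of_localValue_ne_zero P (by rw [map_sub, map_mul, h0]; simp))
  refine ⟨n, ?_⟩
  refine (locallyIn_iff (P := P) (k := k) (d := n • d) ⟨g ^ n, pow_mem_forms g.2 n⟩
    (by rw [valueAt_pow]; exact pow_ne_zero _ hg) ⟨F ^ n, pow_mem_forms hF n⟩).mpr ?_
  convert hn using 1
  refine HomogeneousLocalization.val_injective _ ?_
  rw [HomogeneousLocalization.val_pow, val_fraction, val_fraction, Localization.mk_pow]
  rfl

end Local

/-! ### The saturated ideal, and the effect of removing a point. -/

namespace ZeroDimSubscheme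

variable {k : Type*} [Field k] (Y : ZeroDimSubscheme k)

theorem ideal_isHomogeneous : Y.ideal.IsHomogeneous (forms k) :=
  Ideal.homogeneous_span _ _ fun _ h => h.1

/-- The ideal is only defined by generators. The local conditions, imposed on every component,
survive sums and multiples, so no further forms appear. -/
theorem mem_ideal_iff {d : ℕ × ℕ} {F : CoordRing k} (hF : F ∈ forms k d) :
    F ∈ Y.ideal ↔ ∀ P, LocallyIn (Y.stalkIdeal P) F := by
  refine ⟨fun h => ?_, fun h => Ideal.subset_span ⟨⟨d, hF⟩, h⟩⟩
  suffices H : ∀ d P, LocallyIn (Y.stalkIdeal P) (comp d F) by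
    simpa [comp_of_mem hF] using H d
  clear hF
  intro d P
  revert d
  refine Submodule.span_induction (p := fun F _ => ∀ d, LocallyIn (Y.stalkIdeal P) (comp d F))
    ?_ ?_ ?_ ?_ h
  · rintro F ⟨⟨e, he⟩, hF⟩ d
    by_cases h : e = d
    · subst h
      rw [comp_of_mem he]
      exact hF P
    · rw [comp_of_mem_ne he h]
      exact locallyIn_zero
  · intro d
    rw [map_zero]
    exact locallyIn_zero
  · intro F G _ _ h1 h2 d
    rw [map_add]
    exact (h1 d).add (comp_mem _ _) (comp_mem _ _) (h2 d)
  · intro a F _ h d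
    obtain ⟨s, hs⟩ := sum_comp a
    rw [hs, smul_eq_mul, Finset.sum_mul, map_sum]
    refine (Finset.sum_induction _ (fun G => G ∈ forms k d ∧ LocallyIn (Y.stalkIdeal P) G)
      (fun G H hG hH => ⟨add_mem hG.1 hH.1, hG.2.add hG.1 hH.1 hH.2⟩)
      ⟨zero_mem _, locallyIn_zero⟩ fun e _ => ⟨comp_mem _ _, ?_⟩).2
    by_cases hle : e ≤ d
    · obtain ⟨c, rfl⟩ := le_iff_exists_add.mp hle
      rw [comp_mul_of_mem (comp_mem e a)]
      exact (h c).mul_left (comp_mem e a) (comp_mem c F)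
    · rw [comp_mul_of_not_le (comp_mem e a) hle]
      exact locallyIn_zero

/-- A form that does not vanish at any point of `Y` is a nonzerodivisor modulo `I(Y)`. -/
theorem mem_ideal_of_mul_mem {e d : ℕ × ℕ} {l F : CoordRing k} (hl : l ∈ forms k e)
    (hlY : ∀ P, Y.stalkIdeal P ≠ ⊤ → valueAt P l ≠ 0) (hF : F ∈ forms k d)
    (h : l * F ∈ Y.ideal) : F ∈ Y.ideal := by
  rw [Y.mem_ideal_iff hF]
  intro P
  by_cases hP : Y.stalkIdeal P = ⊤
  · rw [hP]
    exact locallyIn_top F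
  · exact ((Y.mem_ideal_iff (mul_mem_forms hl hF)).mp h P).of_mul_left hl (hlY P hP) hF

/-- The Hilbert function of `Y` is bounded by the degree of `Y`. -/
theorem exists_finrank_forms_le : ∃ D, ∀ d : ℕ × ℕ, Module.finrank k (forms k d) ≤
    D + Module.finrank k
      (forms k d ⊓ Y.ideal.restrictScalars k : Submodule k (CoordRing k)) := by
  have hfin : Finite {P | Y.stalkIdeal P ≠ ⊤} := Y.finite_support
  have hfd : ∀ P : {P | Y.stalkIdeal P ≠ ⊤},
      Module.Finite k (LocalRingAt P.1 ⧸ Y.stalkIdeal P.1) := fun P =>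
    finite_of_isFiniteLength (localValue P.1) (fun _ => isUnit_of_localValue_ne_zero P.1)
      (Y.finite_length P.1)
  refine ⟨Module.finrank k (∀ P : {P | Y.stalkIdeal P ≠ ⊤}, LocalRingAt P.1 ⧸ Y.stalkIdeal P.1),
    fun d => ?_⟩
  choose g hg using fun P : Point k => exists_form_valueAt_ne_zero P d
  -- Forms killed by `φ` lie in `I(Y)`, and the dimension of the target does not depend on `d`.
  let φ : forms k d →ₗ[k] ∀ P : {P | Y.stalkIdeal P ≠ ⊤}, LocalRingAt P.1 ⧸ Y.stalkIdeal P.1 :=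
    LinearMap.pi fun P => (Ideal.Quotient.mkₐ k (Y.stalkIdeal P.1)).toLinearMap ∘ₗ
      fraction P.1 (g P.1) (hg P.1)
  have h1 := LinearMap.finrank_range_add_finrank_ker φ
  have h2 := Submodule.finrank_le (LinearMap.range φ)
  have h3 : (LinearMap.ker φ).map (forms k d).subtype ≤ forms k d ⊓ Y.ideal.restrictScalars k := by
    rintro _ ⟨F, hF, rfl⟩
    refine ⟨F.2, ?_⟩
    refine (Y.mem_ideal_iff F.2).mpr fun P => ?_
    by_cases hP : Y.stalkIdeal P = ⊤
    · rw [hP]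
      exact locallyIn_top _
    · have h := congrFun (LinearMap.mem_ker.mp hF) ⟨P, hP⟩
      exact (locallyIn_iff (g P) (hg P) F).mpr (Ideal.Quotient.eq_zero_iff_mem.mp h)
  have h4 : Module.finrank k (LinearMap.ker φ) ≤ Module.finrank k
      (forms k d ⊓ Y.ideal.restrictScalars k : Submodule k (CoordRing k)) := by
    rw [(Submodule.equivMapOfInjective _ (forms k d).injective_subtype _).finrank_eq]
    have : FiniteDimensional k
        (forms k d ⊓ Y.ideal.restrictScalars k : Submodule k (CoordRing k)) :=
      Submodule.finiteDimensional_of_le inf_le_left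
    exact Submodule.finrank_mono h3
  omega

theorem erase_stalkIdeal_self (P : Point k) : (Y.erase P).stalkIdeal P = ⊤ := by
  simp [erase]

theorem erase_stalkIdeal_of_ne {P Q : Point k} (h : Q ≠ P) :
    (Y.erase P).stalkIdeal Q = Y.stalkIdeal Q := by
  simp [erase, h]

theorem stalkIdeal_ne_top_of_erase {P Q : Point k} (h : (Y.erase P).stalkIdeal Q ≠ ⊤) :
    Y.stalkIdeal Q ≠ ⊤ := by
  by_cases hQ : Q = P
  · subst hQ
    exact absurd (Y.erase_stalkIdeal_self Q) h
  · rwa [Y.erase_stalkIdeal_of_ne hQ] at h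

/-- Length one makes the stalk ideal maximal, and the local ring has only one maximal ideal. -/
theorem stalkIdeal_of_multiplicity_eq_one {P : Point k} (hP : Y.multiplicity P = 1) :
    Y.stalkIdeal P = RingHom.ker (localValue P) := by
  have hs : IsSimpleModule (LocalRingAt P ⧸ Y.stalkIdeal P) (LocalRingAt P ⧸ Y.stalkIdeal P) :=
    Module.length_eq_one_iff.mp hP
  have hmax : (Y.stalkIdeal P).IsMaximal :=
    Ideal.Quotient.maximal_of_isField _ (Ring.isField_iff_isSimpleOrder_ideal.mpr hs.toIsSimpleOrder)
  refine hmax.eq_of_le (RingHom.ker_ne_top _) fun a ha => ?_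
  by_contra h
  exact hmax.ne_top (Ideal.eq_top_of_isUnit_mem _ ha (isUnit_of_localValue_ne_zero P h))

/-- If `X` has multiplicity one at `P`, then `I(X)` consists of the forms in `I(X ∖ {P})` that
vanish at `P`. -/
theorem mem_ideal_iff_erase {P : Point k} (hP : Y.multiplicity P = 1) {d : ℕ × ℕ} {F : CoordRing k}
    (hF : F ∈ forms k d) : F ∈ Y.ideal ↔ F ∈ (Y.erase P).ideal ∧ valueAt P F = 0 := by
  rw [Y.mem_ideal_iff hF, (Y.erase P).mem_ideal_iff hF]
  have hval : LocallyIn (Y.stalkIdeal P) F ↔ valueAt P F = 0 := by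
    obtain ⟨g, hg⟩ := exists_form_valueAt_ne_zero P d
    rw [locallyIn_iff g hg ⟨F, hF⟩, Y.stalkIdeal_of_multiplicity_eq_one hP, RingHom.mem_ker]
    exact localValue_fraction_eq_zero P g hg ⟨F, hF⟩
  constructor
  · refine fun h => ⟨fun Q => ?_, hval.mp (h P)⟩
    by_cases hQ : Q = P
    · subst hQ
      rw [Y.erase_stalkIdeal_self]
      exact locallyIn_top F
    · rw [Y.erase_stalkIdeal_of_ne hQ]
      exact h Q
  · rintro ⟨h1, h2⟩ Q
    by_cases hQ : Q = P
    · subst hQ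
      exact hval.mpr h2
    · rw [← Y.erase_stalkIdeal_of_ne hQ]
      exact h1 Q

end ZeroDimSubscheme

/-! ### Separating a point from the rest of the scheme. -/

section Separation

variable {k : Type*} [Field k]

theorem eq_of_rep_mul_eq {p q : Projectivization k (Fin 2 → k)}
    (h : q.rep 0 * p.rep 1 = q.rep 1 * p.rep 0) : q = p := by
  obtain ⟨i, hi⟩ := exists_rep_ne_zero q
  rw [← p.mk_rep, ← q.mk_rep, eq_comm, Projectivization.mk_eq_mk_iff']
  refine ⟨p.rep i / q.rep i, ?_⟩
  ext j
  fin_cases i <;> fin_cases j <;> simp at hi ⊢ <;> field_simp <;>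
    first | linear_combination h | linear_combination -h

/-- Distinct points are separated by a form of bidegree `(1, 0)` or `(0, 1)`. -/
theorem exists_form_separating {P Q : Point k} (h : Q ≠ P) :
    ∃ d, ∃ F ∈ forms k d, valueAt Q F = 0 ∧ valueAt P F ≠ 0 := by
  by_cases h1 : Q.1 = P.1
  · have h2 : Q.2 ≠ P.2 := fun h2 => h (Prod.ext h1 h2)
    refine ⟨(0, 1), Q.2.rep 0 • X (Sum.inr 1) - Q.2.rep 1 • X (Sum.inr 0),
      sub_mem (Submodule.smul_mem _ _ (X_inr_mem_forms 1))
        (Submodule.smul_mem _ _ (X_inr_mem_forms 0)), ?_, ?_⟩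
    · simp [valueAt, smul_eval]
      ring
    · intro h3
      refine h2 (eq_of_rep_mul_eq ?_)
      simpa [valueAt, smul_eval, sub_eq_zero] using h3
  · refine ⟨(1, 0), Q.1.rep 0 • X (Sum.inl 1) - Q.1.rep 1 • X (Sum.inl 0),
      sub_mem (Submodule.smul_mem _ _ (X_inl_mem_forms 1))
        (Submodule.smul_mem _ _ (X_inl_mem_forms 0)), ?_, ?_⟩
    · simp [valueAt, smul_eval]
      ring
    · intro h3
      refine h1 (eq_of_rep_mul_eq ?_)
      simpa [valueAt, smul_eval, sub_eq_zero] using h3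

/-- Some form vanishes on `Y ∖ {P}` but not at `P`. -/
theorem ZeroDimSubscheme.exists_separator (Y : ZeroDimSubscheme k) (P : Point k) :
    ∃ d, ∃ F ∈ forms k d, F ∈ (Y.erase P).ideal ∧ valueAt P F ≠ 0 := by
  classical
  suffices H : ∀ T : Finset (Point k), P ∉ T → ∃ d, ∃ F ∈ forms k d,
      (∀ Q ∈ T, LocallyIn (Y.stalkIdeal Q) F) ∧ valueAt P F ≠ 0 by
    obtain ⟨d, F, hF, hT, hFP⟩ := H (Y.finite_support.toFinset.erase P) (by simp)
    refine ⟨d, F, hF, ((Y.erase P).mem_ideal_iff hF).mpr fun Q => ?_, hFP⟩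
    by_cases hQ : Q = P
    · subst hQ
      rw [Y.erase_stalkIdeal_self]
      exact locallyIn_top F
    · rw [Y.erase_stalkIdeal_of_ne hQ]
      by_cases hQ' : Y.stalkIdeal Q = ⊤
      · rw [hQ']
        exact locallyIn_top F
      · exact hT Q (by simp [hQ, hQ'])
  intro T
  induction T using Finset.induction_on with
  | empty =>
    intro _
    obtain ⟨g, hg⟩ := exists_form_valueAt_ne_zero P 0
    exact ⟨0, g, g.2, by simp, hg⟩
  | insert Q T _ ih =>
    intro hP
    simp only [Finset.mem_insert, not_or] at hP
    obtain ⟨d, F, hF, hT, hFP⟩ := ih hP.2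
    obtain ⟨e, G, hG, hGQ, hGP⟩ := exists_form_separating (Ne.symm hP.1)
    -- The scheme may be non-reduced at `Q`, so a power of the separating form is needed to enter
    -- the stalk ideal.
    obtain ⟨n, hn⟩ := exists_pow_locallyIn (Y.finite_length Q) hG hGQ
    refine ⟨n • e + d, G ^ n * F, mul_mem_forms (pow_mem_forms hG n) hF, ?_, ?_⟩
    · intro Q' hQ'
      rcases Finset.mem_insert.mp hQ' with rfl | hQ'
      · rw [mul_comm]
        exact hn.mul_left hF (pow_mem_forms hG n)
      · exact (hT Q' hQ').mul_left (pow_mem_forms hG n) hF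
    · rw [valueAt_mul, valueAt_pow]
      exact mul_ne_zero (pow_ne_zero _ hGP) hFP

end Separation

/-! ### Depth two and regular pairs. -/

section Depth

variable {R : Type*} [CommRing R]

/-- An ideal of depth at least two on `R / I` contains a regular sequence of length two. -/
theorem exists_regular_pair {𝔪 I : Ideal R} (h : 2 ≤ depth 𝔪 (R ⧸ I)) :
    ∃ a ∈ 𝔪, ∃ b ∈ 𝔪, (∀ f, a * f ∈ I → f ∈ I) ∧
      ∀ f g, b * f - a * g ∈ I → ∃ z, f - a * z ∈ I := by
  have h1 : (1 : ℕ∞) < depth 𝔪 (R ⧸ I) := lt_of_lt_of_le (by norm_num) h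
  obtain ⟨⟨rs, hrs, hmem⟩, hlen⟩ := lt_iSup_iff.mp h1
  simp only at hlen
  match rs, hrs, hmem, hlen with
  | [], _, _, hlen => simp at hlen
  | [a], _, _, hlen => simp at hlen
  | a :: b :: t, hrs, hmem, _ =>
    have hw := hrs.toIsWeaklyRegular
    rw [RingTheory.Sequence.isWeaklyRegular_cons_iff,
      RingTheory.Sequence.isWeaklyRegular_cons_iff] at hw
    obtain ⟨ha, hb, -⟩ := hw
    refine ⟨a, hmem a (by simp), b, hmem b (by simp), fun f hf => ?_, fun f g hfg => ?_⟩
    · refine Ideal.Quotient.eq_zero_iff_mem.mp (ha.right_eq_zero_of_smul ?_)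
      exact Ideal.Quotient.eq_zero_iff_mem.mpr hf
    · have h2 : b • (Submodule.Quotient.mk (Ideal.Quotient.mk I f) : QuotSMulTop a (R ⧸ I)) = 0 := by
        rw [← Submodule.Quotient.mk_smul, Submodule.Quotient.mk_eq_zero,
          Submodule.mem_smul_pointwise_iff_exists]
        exact ⟨Ideal.Quotient.mk I g, trivial, (Ideal.Quotient.eq.mpr hfg).symm⟩
      have h3 := hb.right_eq_zero_of_smul h2
      rw [Submodule.Quotient.mk_eq_zero, Submodule.mem_smul_pointwise_iff_exists] at h3
      obtain ⟨z, -, hz⟩ := h3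
      obtain ⟨z, rfl⟩ := Ideal.Quotient.mk_surjective z
      exact ⟨z, Ideal.Quotient.eq.mp hz.symm⟩

/-- If `𝔪` has depth at least two on `R / I` and `l` is a nonzerodivisor modulo `I`, then `𝔪`
contains a nonzerodivisor modulo `I + (l)`: nothing is annihilated by a power of `𝔪`. -/
theorem exists_sub_mul_mem_of_pow {𝔪 I : Ideal R} (h : 2 ≤ depth 𝔪 (R ⧸ I)) {l : R}
    (hl : ∀ f, l * f ∈ I → f ∈ I) (n : ℕ) :
    ∀ u, (∀ w ∈ 𝔪 ^ n, ∃ z, w * u - l * z ∈ I) → ∃ z, u - l * z ∈ I := by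
  obtain ⟨a, ha, b, hb, hreg, hpair⟩ := exists_regular_pair h
  -- From `a u ≡ l a'` and `b u ≡ l b'`, cancelling `l` gives `b a' ≡ a b'`. Regularity of the pair
  -- gives `a' ≡ a z`, and cancelling `a` gives `u ≡ l z`.
  have key : ∀ u, (∀ w ∈ 𝔪, ∃ z, w * u - l * z ∈ I) → ∃ z, u - l * z ∈ I := by
    intro u hu
    obtain ⟨a', ha'⟩ := hu a ha
    obtain ⟨b', hb'⟩ := hu b hb
    have h1 : b * a' - a * b' ∈ I := by
      refine hl _ ?_
      have := I.sub_mem (I.mul_mem_left a hb') (I.mul_mem_left b ha')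
      convert this using 1
      ring
    obtain ⟨z, hz⟩ := hpair a' b' h1
    refine ⟨z, hreg _ ?_⟩
    have := I.add_mem ha' (I.mul_mem_left l hz)
    convert this using 1
    ring
  induction n with
  | zero =>
    intro u hu
    simpa using hu 1 (by simp)
  | succ n ih =>
    intro u hu
    refine key u fun v hv => ih (v * u) fun w hw => ?_
    rw [← mul_assoc]
    exact hu _ (by rw [pow_succ]; exact Ideal.mul_mem_mul hw hv)

end Depth

/-! ### Restriction homomorphisms to the two lines through a point. -/

section Restriction

variable {k : Type*} [Field k]

theorem valueAt_eq_aeval (P : Point k) (f : CoordRing k) :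
    valueAt P f = MvPolynomial.aeval (R := k) (Sum.elim P.1.rep P.2.rep) f := by
  simp [valueAt, MvPolynomial.aeval_eq_eval]

/-- The value at `P`, as a homomorphism of algebras. -/
def valueHom (P : Point k) : CoordRing k →ₐ[k] k :=
  MvPolynomial.aeval (Sum.elim P.1.rep P.2.rep)

theorem valueHom_apply (P : Point k) (f : CoordRing k) : valueHom P f = valueAt P f :=
  (valueAt_eq_aeval P f).symm

/-- Restriction to the line of type `(1, 0)` through `P`. -/
def restrictRow (P : Point k) : CoordRing k →ₐ[k] CoordRing k :=
  MvPolynomial.aeval (Sum.elim (fun i => C (P.1.rep i)) (fun j => X (Sum.inr j)))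

/-- Restriction to the line of type `(0, 1)` through `P`. -/
def restrictCol (P : Point k) : CoordRing k →ₐ[k] CoordRing k :=
  MvPolynomial.aeval (Sum.elim (fun i => X (Sum.inl i)) (fun j => C (P.2.rep j)))

theorem valueHom_restrictRow (P : Point k) (f : CoordRing k) :
    valueHom P (restrictRow P f) = valueHom P f := by
  have : (valueHom P).comp (restrictRow P) = valueHom P := by
    ext s
    rcases s with s | s <;> simp [valueHom, restrictRow]
  exact DFunLike.congr_fun this f

theorem valueHom_restrictCol (P : Point k) (f : CoordRing k) :
    valueHom P (restrictCol P f) = valueHom P f := by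
  have : (valueHom P).comp (restrictCol P) = valueHom P := by
    ext s
    rcases s with s | s <;> simp [valueHom, restrictCol]
  exact DFunLike.congr_fun this f

theorem aeval_mem_forms {φ : Fin 2 ⊕ Fin 2 → CoordRing k} {w : Fin 2 ⊕ Fin 2 → ℕ × ℕ}
    (hφ : ∀ s, φ s ∈ forms k (w s)) {d e : ℕ × ℕ} {F : CoordRing k} (hF : F ∈ forms k d)
    (hw : ∀ a : Fin 2 ⊕ Fin 2 →₀ ℕ, Finsupp.weight bidegree a = d → Finsupp.weight w a = e) :
    aeval φ F ∈ forms k e := by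
  rw [F.as_sum, map_sum]
  refine Submodule.sum_mem _ fun a ha => ?_
  rw [aeval_monomial, ← Algebra.smul_def]
  refine Submodule.smul_mem _ _ ?_
  rw [← hw a (hF (mem_support_iff.mp ha)), Finsupp.weight_apply]
  exact IsWeightedHomogeneous.prod a.support (fun s => φ s ^ a s) (fun s => a s • w s)
    fun s _ => (hφ s).pow (a s)

theorem C_mem_forms (c : k) : (C c : CoordRing k) ∈ forms k (0, 0) :=
  isWeightedHomogeneous_C bidegree c

theorem restrictRow_mem (P : Point k) {i j : ℕ} {F : CoordRing k} (hF : F ∈ forms k (i, j)) :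
    restrictRow P F ∈ forms k (0, j) := by
  refine aeval_mem_forms (w := Sum.elim (fun _ => (0, 0)) (fun _ => (0, 1))) ?_ hF ?_
  · rintro (s | s)
    · exact C_mem_forms _
    · exact X_inr_mem_forms s
  · intro a ha
    rw [weight_bidegree, Prod.mk.injEq] at ha
    rw [Finsupp.weight_apply, Finsupp.sum_fintype _ _ (by simp), ← ha.2]
    simp [Fintype.sum_sum_type, Fin.sum_univ_two, -nsmul_eq_mul]

theorem restrictCol_mem (P : Point k) {i j : ℕ} {F : CoordRing k} (hF : F ∈ forms k (i, j)) :
    restrictCol P F ∈ forms k (i, 0) := by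
  refine aeval_mem_forms (w := Sum.elim (fun _ => (1, 0)) (fun _ => (0, 0))) ?_ hF ?_
  · rintro (s | s)
    · exact X_inl_mem_forms s
    · exact C_mem_forms _
  · intro a ha
    rw [weight_bidegree, Prod.mk.injEq] at ha
    rw [Finsupp.weight_apply, Finsupp.sum_fintype _ _ (by simp), ← ha.1]
    simp [Fintype.sum_sum_type, Fin.sum_univ_two, -nsmul_eq_mul]

theorem aeval_eq_self {φ : Fin 2 ⊕ Fin 2 → CoordRing k} {d : ℕ × ℕ} {F : CoordRing k}
    (hF : F ∈ forms k d)
    (hφ : ∀ a, Finsupp.weight bidegree a = d → ∀ s, a s ≠ 0 → φ s = X s) : aeval φ F = F := by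
  conv_rhs => rw [F.as_sum]
  conv_lhs => rw [F.as_sum, map_sum]
  refine Finset.sum_congr rfl fun a ha => ?_
  rw [aeval_monomial, monomial_eq]
  refine congrArg₂ _ rfl (Finsupp.prod_congr fun s hs => ?_)
  rw [hφ a (hF (mem_support_iff.mp ha)) s (Finsupp.mem_support_iff.mp hs)]

theorem restrictRow_eq (P : Point k) {j : ℕ} {F : CoordRing k} (hF : F ∈ forms k (0, j)) :
    restrictRow P F = F := by
  refine aeval_eq_self hF fun a ha s hs => ?_
  rw [weight_bidegree, Prod.mk.injEq] at ha
  rcases s with s | s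
  · fin_cases s <;> simp at hs <;> omega
  · rfl

theorem restrictCol_eq (P : Point k) {i : ℕ} {F : CoordRing k} (hF : F ∈ forms k (i, 0)) :
    restrictCol P F = F := by
  refine aeval_eq_self hF fun a ha s hs => ?_
  rw [weight_bidegree, Prod.mk.injEq] at ha
  rcases s with s | s
  · rfl
  · fin_cases s <;> simp at hs <;> omega

/-- Linear forms defining lines of a ruling restrict to constants on a line of the same ruling; this
reads off the constant. -/
theorem eq_algebraMap_of_mem_forms_zero (P : Point k) {F : CoordRing k} (hF : F ∈ forms k (0, 0)) :
    F = algebraMap k _ (valueHom P F) := by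
  have h1 : Module.finrank k (forms k (0, 0)) = 1 := by rw [finrank_forms]
  have h2 : (⟨1, by simpa using C_mem_forms (1 : k)⟩ : forms k (0, 0)) ≠ 0 := by
    intro h
    exact one_ne_zero (congrArg Subtype.val h)
  obtain ⟨c, hc⟩ := (finrank_eq_one_iff_of_nonzero' _ h2).mp h1 ⟨F, hF⟩
  have h3 : F = algebraMap k _ c := by
    rw [Algebra.algebraMap_eq_smul_one]
    exact (congrArg Subtype.val hc).symm
  rw [h3, AlgHom.commutes]
  rfl

end Restriction

/-! ### Both rulings as instances of `LineRestriction`, the second with transposed bidegrees. -/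

namespace ZeroDimSubscheme

variable {k : Type*} [Field k] (Y : ZeroDimSubscheme k)

/-- The data of restriction to the line of type `(1, 0)` through `P`. -/
theorem lineRestriction_row (P : Point k) {r l m : CoordRing k} (hr : r ∈ forms k (1, 0))
    (hr0 : r ≠ 0) (hrP : valueAt P r = 0) (hl : l ∈ forms k (1, 0)) (hm : m ∈ forms k (0, 1))
    (hlP : valueAt P l ≠ 0) (hmP : valueAt P m ≠ 0)
    (hlY : ∀ Q, Y.stalkIdeal Q ≠ ⊤ → valueAt Q l ≠ 0)
    (hmY : ∀ Q, Y.stalkIdeal Q ≠ ⊤ → valueAt Q m ≠ 0) :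
    LineRestriction (fun i j => forms k (i, j)) Y.ideal r l m (restrictRow P) (valueHom P) where
  finrank_eq := finrank_forms
  mul_mem hF hG := mul_mem_forms hF hG
  r_mem := hr
  l_mem := hl
  m_mem := hm
  r_ne := hr0
  ρ_r := by
    rw [eq_algebraMap_of_mem_forms_zero P (restrictRow_mem P hr), valueHom_restrictRow,
      valueHom_apply, hrP, map_zero]
  ρ_mem hF := restrictRow_mem P hF
  ρ_eq hF := restrictRow_eq P hF
  ρ_l := ⟨valueHom P l, by rwa [valueHom_apply], by
    rw [← valueHom_restrictRow]
    exact eq_algebraMap_of_mem_forms_zero P (restrictRow_mem P hl)⟩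
  e_ρ := valueHom_restrictRow P
  e_m := by rwa [valueHom_apply]
  l_reg hF h := Y.mem_ideal_of_mul_mem hl hlY hF h
  m_reg hF h := Y.mem_ideal_of_mul_mem hm hmY hF h
  bounded := by
    obtain ⟨D, hD⟩ := Y.exists_finrank_forms_le
    exact ⟨D, fun i j => hD (i, j)⟩
  mem_sup {i j F} hF h := exists_sub_mul_mem_of_mem_sup Y.ideal_isHomogeneous hr
    (d := (i, j)) (by rw [Prod.mk_add_mk, add_comm 1 i, zero_add]; exact hF) h

/-- The data of restriction to the line of type `(0, 1)` through `P`. -/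
theorem lineRestriction_col (P : Point k) {c l m : CoordRing k} (hc : c ∈ forms k (0, 1))
    (hc0 : c ≠ 0) (hcP : valueAt P c = 0) (hl : l ∈ forms k (1, 0)) (hm : m ∈ forms k (0, 1))
    (hlP : valueAt P l ≠ 0) (hmP : valueAt P m ≠ 0)
    (hlY : ∀ Q, Y.stalkIdeal Q ≠ ⊤ → valueAt Q l ≠ 0)
    (hmY : ∀ Q, Y.stalkIdeal Q ≠ ⊤ → valueAt Q m ≠ 0) :
    LineRestriction (fun i j => forms k (j, i)) Y.ideal c m l (restrictCol P) (valueHom P) where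
  finrank_eq i j := by rw [finrank_forms, mul_comm]
  mul_mem hF hG := mul_mem_forms hF hG
  r_mem := hc
  l_mem := hm
  m_mem := hl
  r_ne := hc0
  ρ_r := by
    rw [eq_algebraMap_of_mem_forms_zero P (restrictCol_mem P hc), valueHom_restrictCol,
      valueHom_apply, hcP, map_zero]
  ρ_mem hF := restrictCol_mem P hF
  ρ_eq hF := restrictCol_eq P hF
  ρ_l := ⟨valueHom P m, by rwa [valueHom_apply], by
    rw [← valueHom_restrictCol]
    exact eq_algebraMap_of_mem_forms_zero P (restrictCol_mem P hm)⟩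
  e_ρ := valueHom_restrictCol P
  e_m := by rwa [valueHom_apply]
  l_reg hF h := Y.mem_ideal_of_mul_mem hm hmY hF h
  m_reg hF h := Y.mem_ideal_of_mul_mem hl hlY hF h
  bounded := by
    obtain ⟨D, hD⟩ := Y.exists_finrank_forms_le
    exact ⟨D, fun i j => hD (j, i)⟩
  mem_sup {i j F} hF h := exists_sub_mul_mem_of_mem_sup Y.ideal_isHomogeneous hc
    (d := (j, i)) (by rw [Prod.mk_add_mk, add_comm 1 i, zero_add]; exact hF) h

end ZeroDimSubscheme

/-! ### Lines avoiding finitely many points. -/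

section GeneralLines

variable {k : Type*} [Field k] [Infinite k]

/-- Finitely many nonzero vectors of `k²` lie outside the kernel of a common linear form. -/
theorem exists_add_mul_ne_zero (T : Set (Fin 2 → k)) (hT : T.Finite) (h0 : ∀ v ∈ T, v ≠ 0) :
    ∃ t : k, ∀ v ∈ T, v 0 + t * v 1 ≠ 0 := by
  -- When `v 1 = 0` the quotient is `0` by convention; excluding it is harmless, as `v 0 ≠ 0` then.
  obtain ⟨t, ht⟩ := (hT.image fun v => -v 0 / v 1).exists_notMem
  refine ⟨t, fun v hv h => ?_⟩
  by_cases h1 : v 1 = 0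
  · refine h0 v hv ?_
    rw [h1, mul_zero, add_zero] at h
    ext i
    fin_cases i
    · exact h
    · exact h1
  · exact ht ⟨v, hv, by simp only; field_simp; linear_combination -h⟩

theorem exists_row_avoiding {T : Set (Point k)} (hT : T.Finite) :
    ∃ l ∈ forms k (1, 0), ∀ Q ∈ T, valueAt Q l ≠ 0 := by
  obtain ⟨t, ht⟩ := exists_add_mul_ne_zero ((fun Q : Point k => Q.1.rep) '' T) (hT.image _)
    (by rintro _ ⟨Q, -, rfl⟩; exact Q.1.rep_nonzero)
  refine ⟨X (Sum.inl 0) + t • X (Sum.inl 1),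
    add_mem (X_inl_mem_forms 0) (Submodule.smul_mem _ _ (X_inl_mem_forms 1)), fun Q hQ => ?_⟩
  simpa [valueAt, smul_eval] using ht _ ⟨Q, hQ, rfl⟩

theorem exists_col_avoiding {T : Set (Point k)} (hT : T.Finite) :
    ∃ m ∈ forms k (0, 1), ∀ Q ∈ T, valueAt Q m ≠ 0 := by
  obtain ⟨t, ht⟩ := exists_add_mul_ne_zero ((fun Q : Point k => Q.2.rep) '' T) (hT.image _)
    (by rintro _ ⟨Q, -, rfl⟩; exact Q.2.rep_nonzero)
  refine ⟨X (Sum.inr 0) + t • X (Sum.inr 1),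
    add_mem (X_inr_mem_forms 0) (Submodule.smul_mem _ _ (X_inr_mem_forms 1)), fun Q hQ => ?_⟩
  simpa [valueAt, smul_eval] using ht _ ⟨Q, hQ, rfl⟩

end GeneralLines

/-- An upward closed set `T` in `ℕ²` that contains `(i, j)` whenever it contains `(i + 1, j)` and
`(i, j + 1)` contains the pair of its least coordinates. -/
theorem corner_mem {T : ℕ → ℕ → Prop} (h1 : ∀ i j, T i j → T (i + 1) j)
    (h2 : ∀ i j, T i j → T i (j + 1)) (h : ∀ i j, T (i + 1) j → T i (j + 1) → T i j) {q p : ℕ}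
    (m : ℕ) : ∀ n, T (q + n) p → T q (p + m) → T q p := by
  have h2' : ∀ i j n, T i j → T i (j + n) := by
    intro i j n hT
    induction n with
    | zero => exact hT
    | succ n ih => exact h2 _ _ ih
  have h1' : ∀ i j n, T i j → T (i + n) j := by
    intro i j n hT
    induction n with
    | zero => exact hT
    | succ n ih => exact h1 _ _ ih
  induction m with
  | zero => exact fun _ _ hT => hT
  | succ m ih =>
    intro n hn hm
    refine ih n hn ?_
    -- Move left along `j = p + m`: each step uses the known point and its upper left neighbour,
    -- which is in `T` because `(q, p + m + 1)` is.
    have key : ∀ s, T (q + s) (p + m) → T q (p + m) := by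
      intro s
      induction s with
      | zero => exact fun hT => hT
      | succ s ihs => exact fun hT => ihs (h _ _ hT (h1' _ _ s hm))
    exact key n (h2' _ _ m hn)

/-! ### The ACM property and the change of the Hilbert function. -/

namespace ZeroDimSubscheme

variable {k : Type*} [Field k]

/-- If `X` is arithmetically Cohen-Macaulay, then `(l, m)` is a regular sequence on `S(X)` for forms
`l` and `m` of bidegrees `(1, 0)` and `(0, 1)` that do not vanish at any point of `X`. -/
theorem IsACM.exists_sub_mul_mem {X : ZeroDimSubscheme k} (hX : X.IsACM) {l m r c : CoordRing k}
    {ρ σ : CoordRing k →ₐ[k] CoordRing k} {e e' : CoordRing k →ₐ[k] k}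
    (D : LineRestriction (fun i j => forms k (i, j)) X.ideal r l m ρ e)
    (D' : LineRestriction (fun i j => forms k (j, i)) X.ideal c m l σ e')
    {i j : ℕ} {f g : CoordRing k} (hf : f ∈ forms k (i + 1, j)) (hg : g ∈ forms k (i, j + 1))
    (h : m * f - l * g ∈ X.ideal) : ∃ z ∈ forms k (i, j), f - l * z ∈ X.ideal := by
  have hl : l ∈ forms k (1, 0) := D.l_mem
  have hm : m ∈ forms k (0, 1) := D.m_mem
  have hmem : ∀ u, u ∈ X.ideal ⊔ Ideal.span {l} ↔ ∃ z, u - l * z ∈ X.ideal := by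
    intro u
    constructor
    · intro hu
      obtain ⟨v, hv, w, hw, rfl⟩ := Submodule.mem_sup.mp hu
      obtain ⟨z, rfl⟩ := Ideal.mem_span_singleton.mp hw
      exact ⟨z, by simpa using hv⟩
    · rintro ⟨z, hz⟩
      rw [← sub_add_cancel u (l * z)]
      exact add_mem (Ideal.mem_sup_left hz)
        (Ideal.mem_sup_right (Ideal.mul_mem_right _ _ (Ideal.mem_span_singleton_self l)))
  have hcolon : ∀ w, w ∈ (X.ideal ⊔ Ideal.span {l}).colon ({f} : Set (CoordRing k)) ↔
      ∃ z, w * f - l * z ∈ X.ideal := by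
    intro w
    rw [Submodule.mem_colon_singleton, smul_eq_mul, hmem]
  obtain ⟨N, hN⟩ := D.exists_forall_sub_mul_mem
  obtain ⟨N', hN'⟩ := D'.exists_forall_sub_mul_mem
  -- Depth two lets `f` be tested after multiplication by high powers of the variables, so it
  -- suffices that these put `f` into `I(X) + (l)`.
  have hrad : homogeneousMaximalIdeal k ≤
      ((X.ideal ⊔ Ideal.span {l}).colon ({f} : Set (CoordRing k))).radical := by
    refine Ideal.span_le.mpr ?_
    rintro _ ⟨s, rfl⟩
    rcases s with s | s
    · refine ⟨N, (hcolon _).mpr ?_⟩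
      have h1 : MvPolynomial.X (Sum.inl s) ^ N * f ∈ forms k (i + N + 1, j) := by
        have := mul_mem_forms (pow_mem_forms (X_inl_mem_forms (k := k) s) N) hf
        convert this using 2
        ext
        · simp; ring
        · simp
      obtain ⟨G, -, hG⟩ := hN (i + N) (by omega) j _ h1
      exact ⟨G, hG⟩
    · refine ⟨N', (hcolon _).mpr ?_⟩
      have h1 : MvPolynomial.X (Sum.inr s) ^ N' * g ∈ forms k (i, j + N' + 1) := by
        have := mul_mem_forms (pow_mem_forms (X_inr_mem_forms (k := k) s) N') hg
        convert this using 2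
        ext
        · simp
        · simp; ring
      have h2 : MvPolynomial.X (Sum.inr s) ^ N' * f ∈ forms k (i + 1, j + N') := by
        have := mul_mem_forms (pow_mem_forms (X_inr_mem_forms (k := k) s) N') hf
        convert this using 2
        ext
        · simp
        · simp; ring
      obtain ⟨G, hG, hG'⟩ := hN' (j + N') (by omega) i _ h1
      -- With `y` the power of the variable, `y g ≡ m G` gives `m (y f) ≡ l y g ≡ m l G`, and `m`
      -- cancels.
      refine ⟨G, D.m_reg (sub_mem h2 ?_) ?_⟩
      · have := mul_mem_forms hl hG
        convert this using 2
        ext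
        · simp; ring
        · simp
      · have := add_mem (X.ideal.mul_mem_left (MvPolynomial.X (Sum.inr s) ^ N') h)
          (X.ideal.mul_mem_left l hG')
        convert this using 1
        ring
  obtain ⟨n, hn⟩ := Ideal.exists_pow_le_of_le_radical_of_fg hrad
    (IsNoetherian.noetherian (homogeneousMaximalIdeal k))
  have hreg : ∀ u, l * u ∈ X.ideal → u ∈ X.ideal := fun u hu =>
    mem_of_mul_mem_of_forms X.ideal_isHomogeneous hl
      (fun d F hF hlF => D.l_reg (i := d.1) (j := d.2) hF hlF) hu
  have hz := exists_sub_mul_mem_of_pow (𝔪 := homogeneousMaximalIdeal k) (I := X.ideal)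
    (le_of_eq (Eq.symm hX)) hreg n f fun w hw => (hcolon w).mp (hn hw)
  refine exists_sub_mul_mem_of_mem_sup X.ideal_isHomogeneous hl (d := (i, j)) ?_ ((hmem f).mpr hz)
  rw [Prod.mk_add_mk, add_comm 1 i, zero_add]
  exact hf

/-- `Y` has a form of bidegree `(i, j)` in its ideal that does not vanish at `P`. -/
def HasSeparator (Y : ZeroDimSubscheme k) (P : Point k) (i j : ℕ) : Prop :=
  ∃ F ∈ forms k (i, j), F ∈ Y.ideal ∧ valueAt P F ≠ 0

/-- Removing a point of multiplicity one drops the Hilbert function by one in the bidegrees of the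
separators of this point, and leaves it unchanged in the others. -/
theorem hilbertFunction_erase (X : ZeroDimSubscheme k) {P : Point k} (hP : X.multiplicity P = 1)
    (i j : ℕ) [Decidable ((X.erase P).HasSeparator P i j)] :
    hilbertFunction X.ideal i j = hilbertFunction (X.erase P).ideal i j +
      if (X.erase P).HasSeparator P i j then 1 else 0 := by
  have h1 := hilbertFunction_add_finrank X.ideal i j
  have h2 := hilbertFunction_add_finrank (X.erase P).ideal i j
  have : FiniteDimensional k
      (forms k (i, j) ⊓ (X.erase P).ideal.restrictScalars k : Submodule k (CoordRing k)) :=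
    Submodule.finiteDimensional_of_le inf_le_left
  have h3 := finrank_map_add_finrank_inf_ker (valueHom P).toLinearMap
    (forms k (i, j) ⊓ (X.erase P).ideal.restrictScalars k)
  have h4 : forms k (i, j) ⊓ (X.erase P).ideal.restrictScalars k ⊓
      LinearMap.ker (valueHom P).toLinearMap = forms k (i, j) ⊓ X.ideal.restrictScalars k := by
    ext F
    have hiff : valueHom P F = 0 ↔ valueAt P F = 0 := by rw [valueHom_apply]
    constructor
    · rintro ⟨⟨hF, hF'⟩, h0⟩
      exact ⟨hF, (X.mem_ideal_iff_erase hP hF).mpr ⟨hF', hiff.mp h0⟩⟩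
    · rintro ⟨hF, hF'⟩
      have := (X.mem_ideal_iff_erase hP hF).mp hF'
      exact ⟨⟨hF, this.1⟩, hiff.mpr this.2⟩
  rw [h4] at h3
  split_ifs with hT
  · have h5 : (forms k (i, j) ⊓ (X.erase P).ideal.restrictScalars k).map
        (valueHom P).toLinearMap = ⊤ := by
      obtain ⟨F, hF, hF', hFP⟩ := hT
      refine eq_top_iff.mpr fun c _ => ⟨(c / valueAt P F) • F,
        Submodule.smul_mem _ _ ⟨hF, hF'⟩, ?_⟩
      change valueHom P ((c / valueAt P F) • F) = c
      rw [map_smul, valueHom_apply, smul_eq_mul, div_mul_cancel₀ _ hFP]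
    rw [h5, finrank_top, Module.finrank_self] at h3
    omega
  · have h5 : (forms k (i, j) ⊓ (X.erase P).ideal.restrictScalars k).map
        (valueHom P).toLinearMap = ⊥ := by
      rw [eq_bot_iff]
      rintro _ ⟨F, ⟨hF, hF'⟩, rfl⟩
      by_contra h
      exact hT ⟨F, hF, hF', by rwa [← valueHom_apply]⟩
    rw [h5, finrank_bot] at h3
    omega

/-- The Hilbert functions of `X` and `X ∖ {P}` differ by one exactly in the bidegrees at least
`(q, p)`. -/
theorem deltaM_erase (X : ZeroDimSubscheme k) {P : Point k} (hP : X.multiplicity P = 1) {q p : ℕ}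
    (hT : ∀ i j, (X.erase P).HasSeparator P i j ↔ q ≤ i ∧ p ≤ j) (i j : ℤ) :
    (X.erase P).deltaM i j =
      if i = (q : ℤ) ∧ j = (p : ℤ) then X.deltaM i j - 1 else X.deltaM i j := by
  classical
  -- The identity extends to negative indices, where all terms vanish; the mixed difference of the
  -- quadrant's indicator is `1` at `(q, p)` and `0` elsewhere.
  have h : ∀ i j : ℤ, (X.hilbertMatrix i j : ℤ) = (X.erase P).hilbertMatrix i j +
      if (q : ℤ) ≤ i ∧ (p : ℤ) ≤ j then 1 else 0 := by
    intro i j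
    by_cases hij : 0 ≤ i ∧ 0 ≤ j
    · obtain ⟨hi, hj⟩ := hij
      lift i to ℕ using hi
      lift j to ℕ using hj
      rw [hilbertMatrix, hilbertMatrix, X.hilbertFunction_erase hP i j]
      simp [hT]
    · rw [if_neg (by omega)]
      simp [hilbertMatrix, hilbertFunction, hij]
  rw [deltaM, deltaM, h i j, h (i - 1) j, h i (j - 1), h (i - 1) (j - 1)]
  split_ifs <;> omega

end ZeroDimSubscheme

/-- Removing a point `P` of multiplicity one from an arithmetically Cohen-Macaulay scheme `X` changes
`ΔM_X` only in the bidegree `(q, p)`, where it drops by one. -/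
theorem exists_deltaM_erase_eq {k : Type*} [Field k] [IsAlgClosed k]
    (X : ZeroDimSubscheme k) (hX : X.IsACM)
    (P : Point k) (hP : X.multiplicity P = 1)
    (r c : CoordRing k)
    (hr : r ∈ forms k (1, 0)) (hr0 : r ≠ 0) (hrP : valueAt P r = 0)
    (hc : c ∈ forms k (0, 1)) (hc0 : c ≠ 0) (hcP : valueAt P c = 0) :
    ∃ p q : ℕ,
      (X.erase P).HasNumPointsOn r p ∧ (X.erase P).HasNumPointsOn c q ∧
      ∀ i j : ℤ, (X.erase P).deltaM i j =
        if i = (q : ℤ) ∧ j = (p : ℤ) then X.deltaM i j - 1 else X.deltaM i j := by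
  have hinf : Infinite k := IsAlgClosed.instInfinite
  have hfin : (insert P {Q | X.stalkIdeal Q ≠ ⊤}).Finite := X.finite_support.insert P
  obtain ⟨l, hl, hlX⟩ := exists_row_avoiding hfin
  obtain ⟨m, hm, hmX⟩ := exists_col_avoiding hfin
  have hlP := hlX P (Set.mem_insert _ _)
  have hmP := hmX P (Set.mem_insert _ _)
  have hlX' : ∀ Q, X.stalkIdeal Q ≠ ⊤ → valueAt Q l ≠ 0 := fun Q hQ => hlX Q (Or.inr hQ)
  have hmX' : ∀ Q, X.stalkIdeal Q ≠ ⊤ → valueAt Q m ≠ 0 := fun Q hQ => hmX Q (Or.inr hQ)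
  have hlZ : ∀ Q, (X.erase P).stalkIdeal Q ≠ ⊤ → valueAt Q l ≠ 0 := fun Q hQ =>
    hlX' Q (X.stalkIdeal_ne_top_of_erase hQ)
  have hmZ : ∀ Q, (X.erase P).stalkIdeal Q ≠ ⊤ → valueAt Q m ≠ 0 := fun Q hQ =>
    hmX' Q (X.stalkIdeal_ne_top_of_erase hQ)
  have row := (X.erase P).lineRestriction_row P hr hr0 hrP hl hm hlP hmP hlZ hmZ
  have col := (X.erase P).lineRestriction_col P hc hc0 hcP hl hm hlP hmP hlZ hmZ
  obtain ⟨⟨i₀, j₀⟩, F₀, hF₀, hF₀Z, hF₀P⟩ := X.exists_separator P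
  obtain ⟨p, N, hp, ⟨i₁, F₁, hF₁, hF₁Z, hF₁P⟩, hp'⟩ :=
    row.exists_degree ⟨i₀, j₀, F₀, hF₀, hF₀Z, by rwa [valueHom_apply]⟩
  obtain ⟨q, N', hq, ⟨j₁, G₁, hG₁, hG₁Z, hG₁P⟩, hq'⟩ :=
    col.exists_degree ⟨j₀, i₀, F₀, hF₀, hF₀Z, by rwa [valueHom_apply]⟩
  rw [valueHom_apply] at hF₁P hG₁P
  have hup₁ : ∀ i j, (X.erase P).HasSeparator P i j → (X.erase P).HasSeparator P (i + 1) j := by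
    rintro i j ⟨F, hF, hFZ, hFP⟩
    refine ⟨l * F, ?_, Ideal.mul_mem_left _ _ hFZ, by
      rw [valueAt_mul]; exact mul_ne_zero hlP hFP⟩
    simpa using row.pow_l_mul_mem hF 1
  have hup₂ : ∀ i j, (X.erase P).HasSeparator P i j → (X.erase P).HasSeparator P i (j + 1) := by
    rintro i j ⟨F, hF, hFZ, hFP⟩
    refine ⟨m * F, ?_, Ideal.mul_mem_left _ _ hFZ, by
      rw [valueAt_mul]; exact mul_ne_zero hmP hFP⟩
    simpa using row.pow_m_mul_mem hF 1
  have hdiag : ∀ i j, (X.erase P).HasSeparator P (i + 1) j →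
      (X.erase P).HasSeparator P i (j + 1) → (X.erase P).HasSeparator P i j := by
    rintro i j ⟨F, hF, hFZ, hFP⟩ ⟨G, hG, hGZ, hGP⟩
    have hmF : m * F ∈ forms k (i + 1, j + 1) := by simpa using row.pow_m_mul_mem hF 1
    have hlG : l * G ∈ forms k (i + 1, j + 1) := by simpa using row.pow_l_mul_mem hG 1
    -- The two scalars make the values at `P` cancel.
    have hI : m * (valueAt P (l * G) • F) - l * (valueAt P (m * F) • G) ∈ X.ideal := by
      rw [mul_smul_comm, mul_smul_comm]
      refine (X.mem_ideal_iff_erase hP (sub_mem (Submodule.smul_mem _ _ hmF)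
        (Submodule.smul_mem _ _ hlG))).mpr ⟨sub_mem ?_ ?_, ?_⟩
      · exact Submodule.smul_of_tower_mem _ _ (Ideal.mul_mem_left _ _ hFZ)
      · exact Submodule.smul_of_tower_mem _ _ (Ideal.mul_mem_left _ _ hGZ)
      · rw [← valueHom_apply, map_sub, map_smul, map_smul, valueHom_apply, valueHom_apply]
        simp only [smul_eq_mul]
        ring
    obtain ⟨z, hz, hzX⟩ := hX.exists_sub_mul_mem
      (X.lineRestriction_row P hr hr0 hrP hl hm hlP hmP hlX' hmX')
      (X.lineRestriction_col P hc hc0 hcP hl hm hlP hmP hlX' hmX')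
      (Submodule.smul_mem _ _ hF) (Submodule.smul_mem _ _ hG) hI
    have hlz : l * z ∈ forms k (i + 1, j) := by simpa using row.pow_l_mul_mem hz 1
    obtain ⟨hzZ, hzP⟩ := (X.mem_ideal_iff_erase hP
      (sub_mem (Submodule.smul_mem _ _ hF) hlz)).mp hzX
    -- Modulo `I(Z)` both the scaled `F` and its difference with `l z` vanish, and `l` cancels. At
    -- `P` the product `l z` takes the nonzero value of the scaled `F`.
    refine ⟨z, hz, row.l_reg hz ?_, fun h0 => ?_⟩
    · have h1 := sub_mem (Submodule.smul_of_tower_mem (X.erase P).ideal (valueAt P (l * G)) hFZ) hzZ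
      rwa [sub_sub_cancel] at h1
    · rw [← valueHom_apply, map_sub, map_smul, map_mul, valueHom_apply, valueHom_apply,
        valueHom_apply, h0, mul_zero, sub_zero, smul_eq_mul, valueAt_mul] at hzP
      exact mul_ne_zero (mul_ne_zero hlP hGP) hFP hzP
  have hT : ∀ i j, (X.erase P).HasSeparator P i j ↔ q ≤ i ∧ p ≤ j := by
    intro i j
    constructor
    · rintro ⟨F, hF, hFZ, hFP⟩
      rw [← valueHom_apply] at hFP
      exact ⟨hq' j i F hF hFZ hFP, hp' i j F hF hFZ hFP⟩
    · rintro ⟨hi, hj⟩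
      -- `F₁` attains the minimum `p` and `G₁` the minimum `q`, with no control on the other degree;
      -- `corner_mem` combines them.
      have hqi₁ : q ≤ i₁ := hq' p i₁ F₁ hF₁ hF₁Z (by rwa [valueHom_apply])
      have hpj₁ : p ≤ j₁ := hp' q j₁ G₁ hG₁ hG₁Z (by rwa [valueHom_apply])
      have hcorner : (X.erase P).HasSeparator P q p := by
        refine corner_mem hup₁ hup₂ hdiag (j₁ - p) (i₁ - q) ?_ ?_
        · rw [Nat.add_sub_cancel' hqi₁]
          exact ⟨F₁, hF₁, hF₁Z, hF₁P⟩
        · rw [Nat.add_sub_cancel' hpj₁]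
          exact ⟨G₁, hG₁, hG₁Z, hG₁P⟩
      exact Nat.le_induction (Nat.le_induction hcorner (fun n _ => hup₁ n p) i hi)
        (fun n _ => hup₂ i n) j hj
  refine ⟨p, q, ?_, ?_, X.deltaM_erase hP hT⟩
  · exact hasDegree_saturation (isHomogeneous_sup_span (X.erase P).ideal_isHomogeneous hr) hp
  · exact hasDegree_saturation (isHomogeneous_sup_span (X.erase P).ideal_isHomogeneous hc)
      fun i j hi hj => hq j i hj hi

end QuadricPoints

end


theorem mainTheorem5 {k : Type*} [Field k] [IsAlgClosed k]
    (X : QuadricPoints.ZeroDimSubscheme k) (hX : X.IsACM)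
    (P : QuadricPoints.Point k) (hP : X.multiplicity P = 1)
    -- equations `r` and `c` of the `(1,0)`-line and the `(0,1)`-line through `P`
    (r c : QuadricPoints.CoordRing k)
    (hr : r ∈ QuadricPoints.forms k (1, 0)) (hr0 : r ≠ 0) (hrP : QuadricPoints.valueAt P r = 0)
    (hc : c ∈ QuadricPoints.forms k (0, 1)) (hc0 : c ≠ 0) (hcP : QuadricPoints.valueAt P c = 0) :
    ∃ p q : ℕ,
      (X.erase P).HasNumPointsOn r p ∧ (X.erase P).HasNumPointsOn c q ∧
      ∀ i j : ℤ, (X.erase P).deltaM i j =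
        if i = (q : ℤ) ∧ j = (p : ℤ) then X.deltaM i j - 1 else X.deltaM i j :=
  QuadricPoints.exists_deltaM_erase_eq X hX P hP r c hr hr0 hrP hc hc0 hcP
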